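/- \textbf{Setting.} Let $R$ be an integral domain with field of fractions $\mathbb F$, and let $A_0\subseteq A_1\subseteq A_2\subseteq\cdots$ be an increasing sequence of cellular $R$-algebras (in the sense of Graham--Lehrer) with unital inclusions and consistent involutions $*$. Let $(\widehat A_r,\unrhd)$ be the finite poset in the cell datum of $A_r$, and let $A_r^{\unrhd\lambda}$ (resp. $A_r^{\rhd\lambda}$) be the span of the cellular basis elements $c^\mu_{\mathsf u\mathsf v}$ with $\mu\unrhd\lambda$ (resp. $\mu\rhd\lambda$). Let $\Delta_r(\lambda)$ be the right cell module of $A_r$ for $\lambda\in\widehat A_r$; all cell modules are nonzero. Suppose: (D1) $A_0=R$. (D2) Each $\Delta_r(\lambda)$ is a cyclic $A_r$-module. Fix a generator $\delta_r(\lambda)$, a bimodule isomorphism $\alpha_\lambda:A_r^{\unrhd\lambda}/A_r^{\rhd\lambda}\to\Delta_r(\lambda)^*\otimes_R\Delta_r(\lambda)$, and $m_\lambda\in A_r^{\unrhd\lambda}$ with $\alpha_\lambda(m_\lambda+A_r^{\rhd\lambda})=\delta_r(\lambda)^*\otimes\delta_r(\lambda)$. (D3) $m_\lambda^*=m_\lambda$.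 (D4) $A_r\otimes_R\mathbb F$ is split semisimple for all $r$. (D5) For all $r\ge0$ and $\mu\in\widehat A_{r+1}$, the restriction of $\Delta_{r+1}(\mu)$ to $A_r$ has an order preserving cell filtration $0=N_0\subseteq N_1\subseteq\cdots\subseteq N_s$, that is, $N_j/N_{j-1}\cong\Delta_r(\lambda^{(j)})$ with $\lambda^{(1)}\rhd\lambda^{(2)}\rhd\cdots\rhd\lambda^{(s)}$. Write $\lambda\to\mu$ if $\Delta_r(\lambda)$ appears as a subquotient $N_j/N_{j-1}$ of such a filtration. For each edge $\lambda\to\mu$ fix a branching factor $d_{\lambda\to\mu}\in A_{r+1}$ such that, for some such filtration and isomorphisms, with $\lambda=\lambda^{(j)}$, one has $\delta_{r+1}(\mu)\,d_{\lambda\to\mu}\in N_j$ and its class in $N_j/N_{j-1}\cong\Delta_r(\lambda)$ corresponds to $\delta_r(\lambda)$ (one filtration and one choice of isomorphisms serving all edges into $\mu$). (D6) For each edge $\lambda\to\mu$ there is $u_{\lambda\to\mu}\in A_{r+1}$ with $m_\mu d_{\lambda\to\mu}=(u_{\lambda\to\mu})^*m_\lambda$. For $\lambda\in\widehat A_r$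 let $\mathrm{Std}_r(\lambda)$ be the set of paths $\mathsf t=(\mathsf t(0)\to\mathsf t(1)\to\cdots\to\mathsf t(r)=\lambda)$ with $\mathsf t(k)\in\widehat A_k$. Put $d_{\mathsf t}=d_{\mathsf t(r-1)\to\mathsf t(r)}\cdots d_{\mathsf t(0)\to\mathsf t(1)}$, and let $m_{\mathsf t}=m_\lambda d_{\mathsf t}+A_r^{\rhd\lambda}$, which is $\delta_r(\lambda)d_{\mathsf t}\in\Delta_r(\lambda)$ under the identification $(m_\lambda A_r+A_r^{\rhd\lambda})/A_r^{\rhd\lambda}\cong\Delta_r(\lambda)$, $m_\lambda+A_r^{\rhd\lambda}\mapsto\delta_r(\lambda)$. These are the elements of the Murphy basis of $\Delta_r(\lambda)$. For paths write $\mathsf s\unrhd\mathsf t$ if $\mathsf s(j)\unrhd\mathsf t(j)$ for all $j$, and $\mathsf s\rhd\mathsf t$ if moreover $\mathsf s\ne\mathsf t$. A family $L_r\in A_r$ $(r\ge1)$ with $L_r^*=L_r$ and $L_r$ commuting with $A_{r-1}$ is an \emph{additive} family of Jucys--Murphy elements if for all $r\geq 1$ and $\lambda\in\widehat A_r$ the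 element $L_1+\cdots+L_r$ acts on $\Delta_r(\lambda)$ as a scalar $d(\lambda)\in R$; put $d(\lambda)=0$ for $\lambda\in\widehat A_0$. It is a \emph{multiplicative} family if every $L_r$ is invertible in $A_r$ and for all $r\geq 1$ and $\lambda\in\widehat A_r$ the element $L_1\cdots L_r$ acts on $\Delta_r(\lambda)$ as a scalar $d(\lambda)\in R$; put $d(\lambda)=1$ for $\lambda\in\widehat A_0$. \textbf{Theorem.} Suppose $(A_r)_{r\ge0}$ has an additive or multiplicative family of Jucys--Murphy elements $L_i$. Then there are scalars $\kappa_{\mu\to\lambda}\in R$ attached to the edges, with $\kappa_{\mu\to\lambda}=d(\lambda)-d(\mu)$ in the additive case and $\kappa_{\mu\to\lambda}\,d(\mu)=d(\lambda)$ in the multiplicative case, such that for all $r\ge1$, $\lambda\in\widehat A_r$, $\mathsf t\in\mathrm{Std}_r(\lambda)$ and $1\le i\le r$ there are $r_{\mathsf s}\in R$ with $$m_{\mathsf t}L_i=\kappa_{\mathsf t}(i)\,m_{\mathsf t}+\sum_{\mathsf s\in\mathrm{Std}_r(\lambda),\ \mathsf s\rhd\mathsf t}r_{\mathsf s}\,m_{\mathsf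 s},\qquad \kappa_{\mathsf t}(i)=\kappa_{\mathsf t(i-1)\to\mathsf t(i)} .$$ -/

import Mathlib

open scoped TensorProduct RightActions

universe u v w x y

/-- A cell datum on the `R`-algebra `A`.  In the poset `Λ` we write `lam ≤ mu` for
`mu ⊵ lam` (and `lam < mu` for `mu ▷ lam`). -/
structure CellDatum (R : Type u) (A : Type v) [CommRing R] [Ring A] [Algebra R A] where
  /-- the involution `a ↦ a^*` -/
  inv : A →ₗ[R] A
  inv_mul : ∀ a b, inv (a * b) = inv b * inv a
  inv_inv : ∀ a, inv (inv a) = a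
  /-- the finite poset indexing the cells -/
  Λ : Type w
  [order : PartialOrder Λ]
  [finΛ : Fintype Λ]
  /-- the finite index sets `Std(lam)` -/
  Tab : Λ → Type x
  [finTab : ∀ lam, Fintype (Tab lam)]
  /-- the cellular basis `c^lam_{s t}` -/
  c : Module.Basis (Σ lam : Λ, Tab lam × Tab lam) R A
  mul_right : ∀ (lam : Λ) (t : Tab lam) (a : A), ∃ ρ : Tab lam → R, ∀ s : Tab lam,
    c ⟨lam, s, t⟩ * a - ∑ v, ρ v • c ⟨lam, s, v⟩ ∈
      Submodule.span R {b : A | ∃ mu, lam < mu ∧ ∃ p q : Tab mu, b = c ⟨mu, p, q⟩}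
  inv_c : ∀ (lam : Λ) (s t : Tab lam),
    inv (c ⟨lam, s, t⟩) - c ⟨lam, t, s⟩ ∈
      Submodule.span R {b : A | ∃ mu, lam < mu ∧ ∃ p q : Tab mu, b = c ⟨mu, p, q⟩}

attribute [instance] CellDatum.order CellDatum.finΛ CellDatum.finTab

namespace CellDatum

section Basic

variable {R : Type u} {A : Type v} [CommRing R] [Ring A] [Algebra R A]
  (D : CellDatum.{u, v, w, x} R A)

/-- `A^{▷ lam}` -/
def idealGT (lam : D.Λ) : Submodule R A :=
  Submodule.span R {b : A | ∃ mu, lam < mu ∧ ∃ p q : D.Tab mu, b = D.c ⟨mu, p, q⟩}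

/-- `A^{⊵ lam}` -/
def idealGE (lam : D.Λ) : Submodule R A :=
  Submodule.span R {b : A | ∃ mu, lam ≤ mu ∧ ∃ p q : D.Tab mu, b = D.c ⟨mu, p, q⟩}

theorem c_mem_idealGE {lam mu : D.Λ} (h : lam ≤ mu) (p q : D.Tab mu) :
    D.c ⟨mu, p, q⟩ ∈ D.idealGE lam :=
  Submodule.subset_span ⟨mu, h, p, q, rfl⟩

theorem c_mem_idealGT {lam mu : D.Λ} (h : lam < mu) (p q : D.Tab mu) :
    D.c ⟨mu, p, q⟩ ∈ D.idealGT lam :=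
  Submodule.subset_span ⟨mu, h, p, q, rfl⟩

theorem idealGT_le_idealGE {lam mu : D.Λ} (h : lam ≤ mu) : D.idealGT mu ≤ D.idealGE lam := by
  refine Submodule.span_le.2 ?_
  rintro _ ⟨nu, hnu, p, q, rfl⟩
  exact D.c_mem_idealGE (h.trans hnu.le) p q

theorem idealGT_mono {lam mu : D.Λ} (h : lam ≤ mu) : D.idealGT mu ≤ D.idealGT lam := by
  refine Submodule.span_le.2 ?_
  rintro _ ⟨nu, hnu, p, q, rfl⟩
  exact D.c_mem_idealGT (lt_of_le_of_lt h hnu) p q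

theorem c_mul_mem {mu : D.Λ} (p q : D.Tab mu) (a : A) :
    ∃ y ∈ D.idealGT mu, ∃ ρ : D.Tab mu → R,
      D.c ⟨mu, p, q⟩ * a = y + ∑ v, ρ v • D.c ⟨mu, p, v⟩ := by
  obtain ⟨ρ, hρ⟩ := D.mul_right mu q a
  exact ⟨_, hρ p, ρ, by abel⟩

theorem idealGE_mul_mem {lam : D.Λ} {x : A} (hx : x ∈ D.idealGE lam) (a : A) :
    x * a ∈ D.idealGE lam := by
  induction hx using Submodule.span_induction with
  | mem b hb =>
    obtain ⟨mu, hmu, p, q, rfl⟩ := hb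
    obtain ⟨y, hy, ρ, h⟩ := D.c_mul_mem p q a
    rw [h]
    exact add_mem (D.idealGT_le_idealGE hmu hy)
      (sum_mem fun v _ => Submodule.smul_mem _ _ (D.c_mem_idealGE hmu p v))
  | zero => simp
  | add b b' _ _ h h' => rw [add_mul]; exact add_mem h h'
  | smul r b _ h => rw [smul_mul_assoc]; exact Submodule.smul_mem _ _ h

theorem idealGT_mul_mem {lam : D.Λ} {x : A} (hx : x ∈ D.idealGT lam) (a : A) :
    x * a ∈ D.idealGT lam := by
  induction hx using Submodule.span_induction with
  | mem b hb =>
    obtain ⟨mu, hmu, p, q, rfl⟩ := hb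
    obtain ⟨y, hy, ρ, h⟩ := D.c_mul_mem p q a
    rw [h]
    exact add_mem (D.idealGT_mono hmu.le hy)
      (sum_mem fun v _ => Submodule.smul_mem _ _ (D.c_mem_idealGT hmu p v))
  | zero => simp
  | add b b' _ _ h h' => rw [add_mul]; exact add_mem h h'
  | smul r b _ h => rw [smul_mul_assoc]; exact Submodule.smul_mem _ _ h

theorem inv_mem_idealGE {lam : D.Λ} {x : A} (hx : x ∈ D.idealGE lam) :
    D.inv x ∈ D.idealGE lam := by
  induction hx using Submodule.span_induction with
  | mem b hb =>
    obtain ⟨mu, hmu, p, q, rfl⟩ := hb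
    have h := add_mem (D.idealGT_le_idealGE hmu (D.inv_c mu p q)) (D.c_mem_idealGE hmu q p)
    rwa [sub_add_cancel] at h
  | zero => simp
  | add b b' _ _ h h' => rw [map_add]; exact add_mem h h'
  | smul r b _ h => rw [map_smul]; exact Submodule.smul_mem _ _ h

theorem mul_mul_mem_idealGE {lam : D.Λ} {x : A} (hx : x ∈ D.idealGE lam) (a b : A) :
    a * x * b ∈ D.idealGE lam := by
  refine D.idealGE_mul_mem ?_ b
  have h := D.inv_mem_idealGE (D.idealGE_mul_mem (D.inv_mem_idealGE hx) (D.inv a))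
  rwa [D.inv_mul, D.inv_inv, D.inv_inv] at h

theorem repr_idealGT {lam : D.Λ} {x : A} (hx : x ∈ D.idealGT lam) (s t : D.Tab lam) :
    D.c.repr x ⟨lam, s, t⟩ = 0 := by
  classical
  induction hx using Submodule.span_induction with
  | mem b hb =>
    obtain ⟨mu, hmu, p, q, rfl⟩ := hb
    rw [Module.Basis.repr_self, Finsupp.single_apply, if_neg]
    intro h
    exact hmu.ne' (congrArg Sigma.fst h)
  | zero => simp
  | add b b' _ _ h h' => rw [map_add, Finsupp.add_apply, h, h', add_zero]
  | smul r b _ h => rw [map_smul, Finsupp.smul_apply, h, smul_zero]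

theorem repr_sum {lam : D.Λ} (s v : D.Tab lam) (ρ : D.Tab lam → R) :
    D.c.repr (∑ w, ρ w • D.c ⟨lam, s, w⟩) ⟨lam, s, v⟩ = ρ v := by
  classical
  rw [map_sum, Finsupp.finsetSum_apply, Finset.sum_eq_single v]
  · simp
  · intro w _ hw
    rw [map_smul, Finsupp.smul_apply, Module.Basis.repr_self, Finsupp.single_apply, if_neg,
      smul_zero]
    intro h
    simp only [Sigma.mk.injEq, heq_eq_eq, Prod.mk.injEq, true_and] at h
    exact hw h
  · simp

/-- The structure coefficients `r(a; t, v)` of the right action: the coefficient of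
`c^lam_{t v}` in `c^lam_{t t} a` (see `c_mul_sub_mem` for the defining property). -/
noncomputable def coef {lam : D.Λ} (a : A) (t v : D.Tab lam) : R :=
  D.c.repr (D.c ⟨lam, t, t⟩ * a) ⟨lam, t, v⟩

theorem coef_eq {lam : D.Λ} {a : A} {t : D.Tab lam} {ρ : D.Tab lam → R} {s : D.Tab lam}
    (h : D.c ⟨lam, s, t⟩ * a - ∑ v, ρ v • D.c ⟨lam, s, v⟩ ∈ D.idealGT lam) (v : D.Tab lam) :
    D.c.repr (D.c ⟨lam, s, t⟩ * a) ⟨lam, s, v⟩ = ρ v := by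
  have h' := D.repr_idealGT h s v
  rw [map_sub, Finsupp.sub_apply, D.repr_sum, sub_eq_zero] at h'
  exact h'

theorem c_mul_sub_mem {lam : D.Λ} (s t : D.Tab lam) (a : A) :
    D.c ⟨lam, s, t⟩ * a - ∑ v, D.coef a t v • D.c ⟨lam, s, v⟩ ∈ D.idealGT lam := by
  obtain ⟨ρ, hρ⟩ := D.mul_right lam t a
  have h : ∀ v, D.coef a t v = ρ v := fun v => D.coef_eq (hρ t) v
  simp only [h]
  exact hρ s

theorem coef_mul {lam : D.Λ} (a b : A) (t v : D.Tab lam) :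
    D.coef (a * b) t v = ∑ w, D.coef a t w * D.coef b w v := by
  refine D.coef_eq (s := t) (ρ := fun v => ∑ w, D.coef a t w * D.coef b w v) ?_ v
  have h1 := D.idealGT_mul_mem (D.c_mul_sub_mem t t a) b
  have h2 : ∑ w, D.coef a t w • (D.c ⟨lam, t, w⟩ * b - ∑ v, D.coef b w v • D.c ⟨lam, t, v⟩) ∈
      D.idealGT lam :=
    sum_mem fun w _ => Submodule.smul_mem _ _ (D.c_mul_sub_mem t w b)
  have h3 := add_mem h1 h2
  convert h3 using 1
  have h4 : ∑ v, (∑ w, D.coef a t w * D.coef b w v) • D.c ⟨lam, t, v⟩ =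
      ∑ w, D.coef a t w • ∑ v, D.coef b w v • D.c ⟨lam, t, v⟩ := by
    simp only [Finset.sum_smul, Finset.smul_sum, smul_smul]
    exact Finset.sum_comm
  simp only [smul_sub, Finset.sum_sub_distrib, sub_mul, Finset.sum_mul, smul_mul_assoc, mul_assoc]
  rw [h4]
  abel

theorem coef_one {lam : D.Λ} [DecidableEq (D.Tab lam)] (t v : D.Tab lam) :
    D.coef (1 : A) t v = if v = t then 1 else 0 := by
  refine D.coef_eq (s := t) (ρ := fun v => if v = t then 1 else 0) ?_ v
  simp

theorem coef_add {lam : D.Λ} (a b : A) (t v : D.Tab lam) :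
    D.coef (a + b) t v = D.coef a t v + D.coef b t v := by
  simp [coef, mul_add]

theorem coef_zero {lam : D.Λ} (t v : D.Tab lam) : D.coef (0 : A) t v = 0 := by
  simp [coef]

/-- The cell module `Δ(lam)`: the free `R`-module on `Std(lam)`, with right `A`-action
`c_t a = ∑ v, r(a; t, v) c_v`. -/
def CellModule (lam : D.Λ) : Type (max u x) := D.Tab lam → R

noncomputable instance (lam : D.Λ) : AddCommGroup (D.CellModule lam) :=
  inferInstanceAs (AddCommGroup (D.Tab lam → R))

noncomputable instance (lam : D.Λ) : Module R (D.CellModule lam) :=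
  inferInstanceAs (Module R (D.Tab lam → R))

/-- Right multiplication by `a` on the cell module. -/
noncomputable def act {lam : D.Λ} (a : A) : D.CellModule lam →ₗ[R] D.CellModule lam where
  toFun x := fun v => ∑ t, x t * D.coef a t v
  map_add' x y := by
    funext v
    show ∑ t, (x t + y t) * D.coef a t v = ∑ t, x t * D.coef a t v + ∑ t, y t * D.coef a t v
    simp only [add_mul, Finset.sum_add_distrib]
  map_smul' r x := by
    funext v
    show ∑ t, (r * x t) * D.coef a t v = r * ∑ t, x t * D.coef a t v
    simp only [mul_assoc, Finset.mul_sum]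

/-- The cell module as a right `A`-module, that is, as a module over `Aᵐᵒᵖ`. -/
noncomputable instance (lam : D.Λ) : Module Aᵐᵒᵖ (D.CellModule lam) where
  smul a x := D.act a.unop x
  one_smul x := by
    classical
    funext v
    show ∑ t, x t * D.coef (1 : A) t v = x v
    simp only [coef_one, mul_ite, mul_one, mul_zero]
    exact (Finset.sum_ite_eq Finset.univ v x).trans (if_pos (Finset.mem_univ v))
  mul_smul a b x := by
    funext v
    show ∑ t, x t * D.coef (b.unop * a.unop) t v =
      ∑ w, (∑ t, x t * D.coef b.unop t w) * D.coef a.unop w v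
    simp only [coef_mul, Finset.mul_sum, Finset.sum_mul, mul_assoc]
    exact Finset.sum_comm
  smul_zero a := map_zero _
  smul_add a x y := map_add _ x y
  add_smul a b x := by
    funext v
    show ∑ t, x t * D.coef (a.unop + b.unop) t v =
      ∑ t, x t * D.coef a.unop t v + ∑ t, x t * D.coef b.unop t v
    simp only [coef_add, mul_add, Finset.sum_add_distrib]
  zero_smul x := by
    funext v
    show ∑ t, x t * D.coef (0 : A) t v = 0
    simp [coef_zero]

/-- `α` is a bimodule isomorphism `A^{⊵ lam} / A^{▷ lam} ≅ Δ(lam)^* ⊗ Δ(lam)`.  Here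
`Δ(lam)^*` is `Δ(lam)` with the left action `a x^* = (x a^*)^*`. -/
def IsBimoduleIso (lam : D.Λ)
    (α : (↥(D.idealGE lam) ⧸ (D.idealGT lam).submoduleOf (D.idealGE lam)) ≃ₗ[R]
      (D.CellModule lam ⊗[R] D.CellModule lam)) : Prop :=
  ∀ (a b : A) (z : ↥(D.idealGE lam)),
    α (Submodule.Quotient.mk ⟨a * (z : A) * b, D.mul_mul_mem_idealGE z.2 a b⟩) =
      TensorProduct.map (D.act (D.inv a)) (D.act b) (α (Submodule.Quotient.mk z))

/-- An order preserving cell filtration `0 = N 0 ⊆ N 1 ⊆ ⋯ ⊆ N len = M` of a right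
`A`-module `M`, with `N (j+1) / N j ≅ Δ(label j)` and `label 0 ▷ label 1 ▷ ⋯`. -/
structure CellFiltration (M : Type y) [AddCommGroup M] [Module Aᵐᵒᵖ M] where
  len : ℕ
  N : Fin (len + 1) → Submodule Aᵐᵒᵖ M
  N_zero : N 0 = ⊥
  N_last : N (Fin.last len) = ⊤
  N_le : ∀ j : Fin len, N j.castSucc ≤ N j.succ
  label : Fin len → D.Λ
  label_anti : StrictAnti label
  iso : ∀ j : Fin len, (↥(N j.succ) ⧸ (N j.castSucc).submoduleOf (N j.succ)) ≃ₗ[Aᵐᵒᵖ]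
    D.CellModule (label j)

end Basic

end CellDatum

/-- An `F`-algebra is split semisimple if it is isomorphic to a finite product of full
matrix algebras over `F`. -/
def IsSplitSemisimple (F : Type u) (A : Type v) [Field F] [Ring A] [Algebra F A] : Prop :=
  ∃ (n : ℕ) (k : Fin n → ℕ), (∀ i, k i ≠ 0) ∧
    Nonempty (A ≃ₐ[F] (∀ i : Fin n, Matrix (Fin (k i)) (Fin (k i)) F))

/-- An increasing sequence `A 0 ⊆ A 1 ⊆ ⋯` of cellular algebras over `R` with unital
inclusions and consistent involutions, realised inside some `R`-algebra `B` (for instance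
their union). -/
structure CellularTower (R : Type u) (B : Type v) [CommRing R] [Ring B] [Algebra R B] where
  A : ℕ → Subalgebra R B
  mono : Monotone A
  cell : ∀ r, CellDatum.{u, v, w, x} R (A r)
  inv_compat : ∀ (r : ℕ) (a : A r),
    (cell (r + 1)).inv (Subalgebra.inclusion (mono r.le_succ) a) =
      Subalgebra.inclusion (mono r.le_succ) ((cell r).inv a)

namespace CellularTower

section Tower

variable {R : Type u} {B : Type v} [CommRing R] [Ring B] [Algebra R B]
  (T : CellularTower.{u, v, w, x} R B)

/-- The index poset of the cell datum of `A r`. -/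
abbrev Λ (r : ℕ) : Type w := (T.cell r).Λ

/-- The cell module `Δ_r(lam)`. -/
abbrev Δ (r : ℕ) (lam : T.Λ r) : Type (max u x) := (T.cell r).CellModule lam

/-- The inclusion `A s ⊆ A r` for `s ≤ r`. -/
def incl {s r : ℕ} (h : s ≤ r) : T.A s →ₐ[R] T.A r := Subalgebra.inclusion (T.mono h)

/-- The restriction of `Δ_{r+1}(mu)` to `A r`. -/
def Res (r : ℕ) (mu : T.Λ (r + 1)) : Type (max u x) := T.Δ (r + 1) mu

noncomputable instance (r : ℕ) (mu : T.Λ (r + 1)) : AddCommGroup (T.Res r mu) :=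
  inferInstanceAs (AddCommGroup (T.Δ (r + 1) mu))

noncomputable instance (r : ℕ) (mu : T.Λ (r + 1)) : Module (T.A r)ᵐᵒᵖ (T.Res r mu) :=
  Module.compHom (T.Δ (r + 1) mu) (RingHom.op (T.incl r.le_succ).toRingHom)

/-- The identity map from `Δ_{r+1}(mu)` to its restriction. -/
def toRes (r : ℕ) (mu : T.Λ (r + 1)) : T.Δ (r + 1) mu → T.Res r mu := id

/-- Each `Res (Δ_{r+1}(mu))` has an order preserving cell filtration. -/
def RestrictionCoherent : Prop :=
  ∀ (r : ℕ) (mu : T.Λ (r + 1)), Nonempty ((T.cell r).CellFiltration (T.Res r mu))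

/-- The edges `lam → mu` of the branching diagram: `Δ_r(lam)` appears as a subquotient of an
order preserving cell filtration of `Res (Δ_{r+1}(mu))`. -/
def Edge {r : ℕ} (lam : T.Λ r) (mu : T.Λ (r + 1)) : Prop :=
  ∃ Φ : (T.cell r).CellFiltration (T.Res r mu), ∃ j, Φ.label j = lam

/-- A path `t(0) → t(1) → ⋯ → t(r)` in the branching diagram. -/
@[ext] structure Path (r : ℕ) where
  vertex : ∀ k, k ≤ r → T.Λ k
  edge : ∀ (k : ℕ) (h : k + 1 ≤ r),
    T.Edge (vertex k (k.le_succ.trans h)) (vertex (k + 1) h)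

variable {T}

/-- Dominance order on paths: `Dominates s t` is `s ⊵ t`. -/
def Path.Dominates {r : ℕ} (s t : T.Path r) : Prop :=
  ∀ (j : ℕ) (h : j ≤ r), t.vertex j h ≤ s.vertex j h

/-- Strict dominance order on paths: `s ▷ t`. -/
def Path.StrictlyDominates {r : ℕ} (s t : T.Path r) : Prop :=
  s ≠ t ∧ s.Dominates t

variable (T)

/-- `Std_r(lam)`: the paths of length `r` ending at `lam`. -/
def Std (r : ℕ) (lam : T.Λ r) : Type w := {t : T.Path r // t.vertex r le_rfl = lam}

instance (r : ℕ) (lam : T.Λ r) : Finite (T.Std r lam) := by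
  refine Finite.of_injective
    (fun (t : T.Std r lam) (k : Fin (r + 1)) => t.1.vertex k (Nat.le_of_lt_succ k.2)) ?_
  intro s t h
  refine Subtype.ext (Path.ext ?_)
  funext k hk
  exact congrFun h ⟨k, Nat.lt_succ_of_le hk⟩

noncomputable instance (r : ℕ) (lam : T.Λ r) : Fintype (T.Std r lam) := Fintype.ofFinite _

/-- The conditions common to additive and multiplicative Jucys--Murphy elements: `L r` is
`*`-invariant and commutes with `A (r-1)`, for `r ≥ 1`.  The value `L 0` plays no role. -/
structure IsJMFamily (L : ∀ r, T.A r) : Prop where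
  inv_eq : ∀ r, 1 ≤ r → (T.cell r).inv (L r) = L r
  commute : ∀ (r : ℕ) (a : T.A r), Commute (L (r + 1)) (T.incl r.le_succ a)

/-- `L 1, L 2, …` is an additive family of Jucys--Murphy elements, where `L 1 + ⋯ + L r` acts
on `Δ_r(lam)` as the scalar `d(lam) = e r lam`. -/
structure IsAdditiveJM (L : ∀ r, T.A r) (e : ∀ r, T.Λ r → R) : Prop
    extends T.IsJMFamily L where
  scalar : ∀ (r : ℕ), 1 ≤ r → ∀ (lam : T.Λ r) (z : T.Δ r lam),
    z <• (∑ i : Fin r, T.incl (Nat.succ_le_of_lt i.2) (L (i + 1))) = e r lam • z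
  scalar_zero : ∀ lam : T.Λ 0, e 0 lam = 0

/-- `L 1, L 2, …` is a multiplicative family of Jucys--Murphy elements, where `L 1 ⋯ L r` acts
on `Δ_r(lam)` as the scalar `d(lam) = e r lam`. -/
structure IsMultiplicativeJM (L : ∀ r, T.A r) (e : ∀ r, T.Λ r → R) : Prop
    extends T.IsJMFamily L where
  isUnit : ∀ r, 1 ≤ r → IsUnit (L r)
  scalar : ∀ (r : ℕ), 1 ≤ r → ∀ (lam : T.Λ r) (z : T.Δ r lam),
    z <• (List.ofFn fun i : Fin r => T.incl (Nat.succ_le_of_lt i.2) (L (i + 1))).prod =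
      e r lam • z
  scalar_zero : ∀ lam : T.Λ 0, e 0 lam = 1

end Tower

end CellularTower

/-- `T` is a sequence of diagram algebras over `R`, with `F` the field of fractions of `R`:
the axioms for the increasing sequence `T` of cellular algebras, with the choices made for it
(generators `δ` of the cell modules, bimodule isomorphisms `α`, elements `m`, branching
factors `d`). -/
structure DiagramStructure {R : Type u} (F : Type y) {B : Type v} [CommRing R] [Field F]
    [Algebra R F] [Ring B] [Algebra R B] (T : CellularTower.{u, v, w, x} R B) where
  /-- cell modules are nonzero -/
  tab_nonempty : ∀ (r : ℕ) (lam : T.Λ r), Nonempty ((T.cell r).Tab lam)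
  /-- `A 0 = R` -/
  zero_eq : Function.Bijective (algebraMap R (T.A 0))
  /-- the chosen generator of the cyclic module `Δ_r(lam)` -/
  δ : ∀ (r : ℕ) (lam : T.Λ r), T.Δ r lam
  cyclic : ∀ (r : ℕ) (lam : T.Λ r), Submodule.span (T.A r)ᵐᵒᵖ {δ r lam} = ⊤
  /-- the chosen bimodule isomorphism `A_r^{⊵ lam} / A_r^{▷ lam} ≅ Δ_r(lam)^* ⊗ Δ_r(lam)` -/
  α : ∀ (r : ℕ) (lam : T.Λ r),
    (↥((T.cell r).idealGE lam) ⧸ ((T.cell r).idealGT lam).submoduleOf ((T.cell r).idealGE lam))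
      ≃ₗ[R] (T.Δ r lam ⊗[R] T.Δ r lam)
  α_bimodule : ∀ (r : ℕ) (lam : T.Λ r), (T.cell r).IsBimoduleIso lam (α r lam)
  /-- the chosen lift `m_lam ∈ A_r^{⊵ lam}` of `α⁻¹(δ^* ⊗ δ)` -/
  m : ∀ (r : ℕ) (_ : T.Λ r), T.A r
  m_mem : ∀ (r : ℕ) (lam : T.Λ r), m r lam ∈ (T.cell r).idealGE lam
  α_m : ∀ (r : ℕ) (lam : T.Λ r),
    α r lam (Submodule.Quotient.mk ⟨m r lam, m_mem r lam⟩) = δ r lam ⊗ₜ[R] δ r lam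
  m_inv : ∀ (r : ℕ) (lam : T.Λ r), (T.cell r).inv (m r lam) = m r lam
  split_semisimple : ∀ r, IsSplitSemisimple F (F ⊗[R] T.A r)
  restriction_coherent : T.RestrictionCoherent
  /-- the branching factor `d_{lam → mu}` in `A (r+1)` (only its values on edges matter) -/
  d : ∀ (r : ℕ) (_ : T.Λ r) (_ : T.Λ (r + 1)), T.A (r + 1)
  /-- The branching factors come from a cell filtration of `Res (Δ_{r+1}(mu))`: the
  isomorphism `N (j+1) / N j ≅ Δ_r(lam)`, with `lam = label j`, sends the class of
  `δ(mu) d_{lam → mu}` to the generator `δ(lam)`. -/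
  d_spec : ∀ (r : ℕ) (mu : T.Λ (r + 1)),
    ∃ Φ : (T.cell r).CellFiltration (T.Res r mu), ∀ j : Fin Φ.len,
      ∃ h : T.toRes r mu (δ (r + 1) mu <• d r (Φ.label j) mu) ∈ Φ.N j.succ,
        Φ.iso j (Submodule.Quotient.mk ⟨_, h⟩) = δ r (Φ.label j)
  /-- compatibility: `m_mu d_{lam → mu} = (u_{lam → mu})^* m_lam` for some `u` in `A (r+1)` -/
  compat : ∀ (r : ℕ) (lam : T.Λ r) (mu : T.Λ (r + 1)), T.Edge lam mu →
    ∃ u : T.A (r + 1),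
      m (r + 1) mu * d r lam mu = (T.cell (r + 1)).inv u * T.incl r.le_succ (m r lam)

namespace DiagramStructure

section Murphy

variable {R : Type u} {F : Type y} {B : Type v} [CommRing R] [Field F]
  [Algebra R F] [Ring B] [Algebra R B] {T : CellularTower.{u, v, w, x} R B}
  (S : DiagramStructure F T)

/-- `d_{t(k-1) → t(k)} ⋯ d_{t(0) → t(1)}`, an element of `A k`. -/
def dPrefix {r : ℕ} (t : T.Path r) : ∀ k, k ≤ r → T.A k
  | 0, _ => 1
  | k + 1, h =>
    S.d k (t.vertex k (k.le_succ.trans h)) (t.vertex (k + 1) h) *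
      T.incl k.le_succ (dPrefix t k (k.le_succ.trans h))

/-- `d_t = d_{t(r-1) → t(r)} ⋯ d_{t(0) → t(1)}`. -/
def dPath {r : ℕ} (t : T.Path r) : T.A r := S.dPrefix t r le_rfl

/-- The Murphy basis element `m_t` of `Δ_r(lam)`.  It is `δ(lam) d_t`, which is what
`m_lam d_t + A_r^{▷ lam}` becomes under the identification
`(m_lam A_r + A_r^{▷ lam}) / A_r^{▷ lam} ≅ Δ_r(lam)` sending the class of `m_lam` to `δ(lam)`. -/
noncomputable def murphy {r : ℕ} {lam : T.Λ r} (t : T.Std r lam) : T.Δ r lam :=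
  S.δ r lam <• S.dPath t.1

/-- The representative `m_lam d_t` of the Murphy basis element in `A r`. -/
def murphyRep {r : ℕ} {lam : T.Λ r} (t : T.Std r lam) : T.A r :=
  S.m r lam * S.dPath t.1

end Murphy

end DiagramStructure

/-!
Every two-sided ideal of a split semisimple algebra has an identity element.  For an upper set `U` of
`Λ k`, the span `J_U` of the cellular basis elements of `A_k` with labels in `U` is a two-sided ideal;
after clearing denominators it contains an element `e` with `b e = ρ b` for all `b ∈ J_U`, where
`ρ ≠ 0` (`CellDatum.exists_rightIdentity`).  Such an `e` acts on `Δ_k(lam)` as `ρ` if `lam ∈ U`, and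
as `0` otherwise.  This makes it possible to argue over `R` as one does over `F` with the central
idempotents of the `A_k`.

Two facts link `J_U` to the Murphy basis.  First, iterating `m_mu d_{lam → mu} = u^* m_lam` writes
`m_lam d_t` as a left multiple of `m_{t(k)} d_{t(0) → ⋯ → t(k)}`, which lies in `J_U` if `t(k) ∈ U`;
hence `m_t e = ρ m_t` (`DiagramStructure.murphy_smul_eq`).  Secondly, by induction along the cell
filtrations, `Δ_r(lam) J_U` lies in the span of the `m_s` with `s(k) ∈ U`
(`DiagramStructure.repr_smul_eq_zero`).  That the Murphy elements form a basis follows from the cell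
filtrations as well, once it is known that the edges `lam → mu` are given by the labels of any one
filtration (`CellDatum.CellFiltration.exists_label_eq`).

Take `U = {nu | nu ⊵ t(j)}` for each `j`.  As `L_i` commutes with `A_j` for `j < i` and lies in `A_j`
for `j ≥ i`, a nonzero multiple of `m_t L_i` lies in `Δ_r(lam) J_U`, so only `m_s` with `s ⊵ t` occur
in `m_t L_i` (`DiagramStructure.repr_murphy_smul_eq_zero`).  For the coefficient of `m_t`, take
`U = {nu | nu ▷ t(k)}`: if `z` denotes the sum or product of `L_1, …, L_k`, a nonzero multiple of
`m_t z - d(t(k)) m_t` lies in `Δ_r(lam) J_U`, so `m_t` occurs in `m_t z` with coefficient `d(t(k))`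
(`DiagramStructure.repr_murphy_smul_of_scalar`).  Comparing `k` and `k + 1` gives the coefficient of
`m_t` in `m_t L_{k+1}`.  In the multiplicative case `d(t(k))` is a unit because the `L_i` are.
-/

theorem IsSplitSemisimple.isSemisimpleRing {F : Type u} {A : Type v} [Field F] [Ring A]
    [Algebra F A] (h : IsSplitSemisimple F A) : IsSemisimpleRing A := by
  obtain ⟨n, k, hk, ⟨φ⟩⟩ := h
  have : ∀ i, NeZero (k i) := fun i => ⟨hk i⟩
  exact φ.symm.toRingEquiv.isSemisimpleRing

namespace CellDatum

/-! ### Ideals attached to upper sets -/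

section Ideals

variable {R : Type u} {A : Type v} [CommRing R] [Ring A] [Algebra R A]
  (D : CellDatum.{u, v, w, x} R A)

/-- The span of the cellular basis elements `c^mu_{p q}` with `mu ∈ U`.  It is a two-sided ideal
when `U` is an upper set; `A^{⊵ lam}` and `A^{▷ lam}` are the cases `U = Set.Ici lam` and
`U = Set.Ioi lam`. -/
def upperIdeal (U : Set D.Λ) : Submodule R A :=
  Submodule.span R {b : A | ∃ mu, mu ∈ U ∧ ∃ p q : D.Tab mu, b = D.c ⟨mu, p, q⟩}

theorem upperIdeal_mono {U V : Set D.Λ} (h : U ⊆ V) : D.upperIdeal U ≤ D.upperIdeal V :=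
  Submodule.span_mono fun _ ⟨mu, hmu, hb⟩ => ⟨mu, h hmu, hb⟩

theorem idealGE_le_upperIdeal {U : Set D.Λ} (hU : IsUpperSet U) {lam : D.Λ} (h : lam ∈ U) :
    D.idealGE lam ≤ D.upperIdeal U :=
  D.upperIdeal_mono (U := Set.Ici lam) fun _ hmu => hU hmu h

theorem mul_mul_mem_upperIdeal {U : Set D.Λ} (hU : IsUpperSet U) {z : A}
    (hz : z ∈ D.upperIdeal U) (a b : A) : a * z * b ∈ D.upperIdeal U := by
  induction hz using Submodule.span_induction with
  | mem z hz =>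
    obtain ⟨mu, hmu, p, q, rfl⟩ := hz
    exact D.idealGE_le_upperIdeal hU hmu (D.mul_mul_mem_idealGE (D.c_mem_idealGE le_rfl p q) a b)
  | zero => simp
  | add z z' _ _ h h' => rw [mul_add, add_mul]; exact add_mem h h'
  | smul r z _ h => rw [mul_smul_comm, smul_mul_assoc]; exact Submodule.smul_mem _ _ h

theorem mul_left_mem_upperIdeal {U : Set D.Λ} (hU : IsUpperSet U) {z : A}
    (hz : z ∈ D.upperIdeal U) (a : A) : a * z ∈ D.upperIdeal U := by
  simpa using D.mul_mul_mem_upperIdeal hU hz a 1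

theorem mul_right_mem_upperIdeal {U : Set D.Λ} (hU : IsUpperSet U) {z : A}
    (hz : z ∈ D.upperIdeal U) (a : A) : z * a ∈ D.upperIdeal U := by
  simpa using D.mul_mul_mem_upperIdeal hU hz 1 a

theorem repr_upperIdeal {U : Set D.Λ} {z : A} (hz : z ∈ D.upperIdeal U) {lam : D.Λ}
    (hlam : lam ∉ U) (s t : D.Tab lam) : D.c.repr z ⟨lam, s, t⟩ = 0 := by
  classical
  induction hz using Submodule.span_induction with
  | mem b hb =>
    obtain ⟨mu, hmu, p, q, rfl⟩ := hb
    rw [Module.Basis.repr_self, Finsupp.single_apply, if_neg]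
    intro h
    obtain rfl : mu = lam := congrArg Sigma.fst h
    exact hlam hmu
  | zero => simp
  | add b b' _ _ h h' => rw [map_add, Finsupp.add_apply, h, h', add_zero]
  | smul r b _ h => rw [map_smul, Finsupp.smul_apply, h, smul_zero]

theorem inv_one : D.inv 1 = 1 := by
  have h := D.inv_mul (D.inv 1) 1
  rwa [mul_one, D.inv_inv, mul_one, eq_comm] at h

end Ideals

/-! ### Action on cell modules -/

section CellModules

variable {R : Type u} {A : Type v} [CommRing R] [Ring A] [Algebra R A]
  (D : CellDatum.{u, v, w, x} R A) {lam : D.Λ}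

theorem coef_smul (r : R) (a : A) (t v : D.Tab lam) : D.coef (r • a) t v = r * D.coef a t v := by
  simp [coef]

instance : IsScalarTower R Aᵐᵒᵖ (D.CellModule lam) where
  smul_assoc r a z := by
    funext v
    show ∑ t, z t * D.coef (r • a.unop) t v = r * ∑ t, z t * D.coef a.unop t v
    simp only [coef_smul, Finset.mul_sum]
    exact Finset.sum_congr rfl fun t _ => by ring

instance : SMulCommClass Aᵐᵒᵖ R (D.CellModule lam) where
  smul_comm a r z := (D.act a.unop).map_smul r z

theorem act_apply (a : A) (z : D.CellModule lam) : D.act a z = z <• a := rfl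

theorem cellModule_smul_eq_zero {U : Set D.Λ} (hU : IsUpperSet U) (hlam : lam ∉ U) {a : A}
    (ha : a ∈ D.upperIdeal U) (z : D.CellModule lam) : z <• a = 0 := by
  funext v
  show ∑ t, z t * D.coef a t v = 0
  refine Finset.sum_eq_zero fun t _ => ?_
  rw [coef, D.repr_upperIdeal (D.mul_left_mem_upperIdeal hU ha _) hlam, mul_zero]

theorem cellModule_smul_eq_smul {U : Set D.Λ} (hlam : lam ∈ U) {e : A} {ρ : R}
    (he : ∀ b ∈ D.upperIdeal U, b * e = ρ • b) (z : D.CellModule lam) : z <• e = ρ • z := by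
  classical
  have hc : ∀ t v : D.Tab lam, D.coef e t v = ρ * if v = t then 1 else 0 := fun t v => by
    rw [← D.coef_one, coef, he _ (Submodule.subset_span ⟨lam, hlam, t, t, rfl⟩), map_smul, coef,
      mul_one]
    rfl
  funext v
  show ∑ t, z t * D.coef e t v = ρ * z v
  simp [hc, mul_comm]

theorem smul_cellModule_eq_zero [IsDomain R] {ρ : R} (hρ : ρ ≠ 0) {z : D.CellModule lam}
    (h : ρ • z = 0) : z = 0 := by
  funext v
  have hv : ρ * z v = 0 := congrFun h v
  exact (mul_eq_zero.1 hv).resolve_left hρ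

theorem eq_zero_of_tmul_eq_zero [IsDomain R] {z y : D.CellModule lam} (hz : z ≠ 0)
    (h : z ⊗ₜ[R] y = 0) : y = 0 := by
  obtain ⟨t, ht⟩ : ∃ t, z t ≠ 0 := by
    by_contra! hz'
    exact hz (funext hz')
  let f : D.CellModule lam →ₗ[R] R := LinearMap.proj (R := R) (φ := fun _ : D.Tab lam => R) t
  have hp : z t • y = 0 := by
    have := congrArg (TensorProduct.lid R _) (congrArg (TensorProduct.map f LinearMap.id) h)
    rwa [map_zero, map_zero, TensorProduct.map_tmul, TensorProduct.lid_tmul] at this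
  exact D.smul_cellModule_eq_zero ht hp

end CellModules

/-! ### Identity elements of the ideals, up to a scalar -/

section RightIdentity

variable {R : Type u} {F : Type y} {A : Type v} [CommRing R] [IsDomain R] [Field F] [Algebra R F]
  [IsFractionRing R F] [Ring A] [Algebra R A] (D : CellDatum.{u, v, w, x} R A)

/-- Elements of the left ideal of `F ⊗ A` generated by `upperIdeal U` become elements of
`upperIdeal U` after clearing denominators. -/
theorem exists_smul_eq_of_mem_span {U : Set D.Λ} (hU : IsUpperSet U) {z : F ⊗[R] A}
    (hz : z ∈ Ideal.span ((fun b : A => (1 : F) ⊗ₜ[R] b) '' (D.upperIdeal U : Set A))) :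
    ∃ ρ : R, ρ ≠ 0 ∧ ∃ b ∈ D.upperIdeal U, ρ • z = (1 : F) ⊗ₜ[R] b := by
  have add_aux : ∀ z z' : F ⊗[R] A,
      (∃ ρ : R, ρ ≠ 0 ∧ ∃ b ∈ D.upperIdeal U, ρ • z = (1 : F) ⊗ₜ[R] b) →
      (∃ ρ : R, ρ ≠ 0 ∧ ∃ b ∈ D.upperIdeal U, ρ • z' = (1 : F) ⊗ₜ[R] b) →
      ∃ ρ : R, ρ ≠ 0 ∧ ∃ b ∈ D.upperIdeal U, ρ • (z + z') = (1 : F) ⊗ₜ[R] b := by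
    rintro z z' ⟨ρ, hρ, b, hb, h⟩ ⟨ρ', hρ', b', hb', h'⟩
    refine ⟨ρ * ρ', mul_ne_zero hρ hρ', ρ' • b + ρ • b',
      add_mem (Submodule.smul_mem _ _ hb) (Submodule.smul_mem _ _ hb'), ?_⟩
    rw [TensorProduct.tmul_add, TensorProduct.tmul_smul, TensorProduct.tmul_smul, ← h, ← h',
      smul_add, smul_smul, smul_smul, mul_comm ρ' ρ]
  induction hz using Submodule.span_induction with
  | mem z hz =>
    obtain ⟨b, hb, rfl⟩ := hz
    exact ⟨1, one_ne_zero, b, hb, one_smul _ _⟩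
  | zero => exact ⟨1, one_ne_zero, 0, zero_mem _, by simp⟩
  | add z z' _ _ h h' => exact add_aux z z' h h'
  | smul y z _ h =>
    obtain ⟨ρ, hρ, b, hb, h⟩ := h
    induction y using TensorProduct.induction_on with
    | zero => exact ⟨1, one_ne_zero, 0, zero_mem _, by simp⟩
    | add y y' hy hy' => rw [add_smul]; exact add_aux _ _ hy hy'
    | tmul f a =>
      obtain ⟨p, q, hq, rfl⟩ := IsFractionRing.div_surjective (A := R) f
      have hq0 : q ≠ 0 := nonZeroDivisors.ne_zero hq
      have hqF : algebraMap R F q ≠ 0 := by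
        simpa using hq0
      refine ⟨q * ρ, mul_ne_zero hq0 hρ, p • (a * b),
        Submodule.smul_mem _ _ (D.mul_left_mem_upperIdeal hU hb a), ?_⟩
      rw [smul_eq_mul, mul_smul, ← mul_smul_comm, h, Algebra.TensorProduct.tmul_mul_tmul, mul_one,
        TensorProduct.smul_tmul', TensorProduct.tmul_smul, TensorProduct.smul_tmul',
        Algebra.smul_def, Algebra.smul_def, mul_one, mul_div_cancel₀ _ hqF]

/-- In a semisimple algebra a two-sided ideal has an identity element.  Clearing denominators, the
ideal `upperIdeal U` of `A` contains an element acting on it from the right as a nonzero scalar. -/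
theorem exists_rightIdentity (hss : IsSplitSemisimple F (F ⊗[R] A)) {U : Set D.Λ}
    (hU : IsUpperSet U) :
    ∃ e ∈ D.upperIdeal U, ∃ ρ : R, ρ ≠ 0 ∧ ∀ b ∈ D.upperIdeal U, b * e = ρ • b := by
  have := hss.isSemisimpleRing
  have := Module.Free.of_basis D.c
  obtain ⟨f, hf, hspan⟩ := IsSemisimpleRing.ideal_eq_span_idempotent
    (Ideal.span ((fun b : A => (1 : F) ⊗ₜ[R] b) '' (D.upperIdeal U : Set A)))
  have hfmem : f ∈ Ideal.span ((fun b : A => (1 : F) ⊗ₜ[R] b) '' (D.upperIdeal U : Set A)) := by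
    rw [hspan]; exact Ideal.mem_span_singleton_self f
  obtain ⟨ρ, hρ, e, he, hfe⟩ := D.exists_smul_eq_of_mem_span hU hfmem
  refine ⟨e, he, ρ, hρ, fun b hb => ?_⟩
  have hbf : ((1 : F) ⊗ₜ[R] b) * f = (1 : F) ⊗ₜ[R] b := by
    have hmem : (1 : F) ⊗ₜ[R] b ∈
        Ideal.span ((fun b : A => (1 : F) ⊗ₜ[R] b) '' (D.upperIdeal U : Set A)) :=
      Ideal.subset_span ⟨b, hb, rfl⟩
    rw [hspan, Ideal.mem_span_singleton'] at hmem
    obtain ⟨a, ha⟩ := hmem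
    rw [← ha, mul_assoc, hf.eq]
  apply Algebra.TensorProduct.includeRight_injective (A := F) (B := A) (IsFractionRing.injective R F)
  show (1 : F) ⊗ₜ[R] (b * e) = (1 : F) ⊗ₜ[R] (ρ • b)
  rw [TensorProduct.tmul_smul, ← hbf, ← mul_smul_comm, hfe, Algebra.TensorProduct.tmul_mul_tmul,
    mul_one]

end RightIdentity

end CellDatum

/-! ### Cell filtrations -/

namespace CellDatum.CellFiltration

variable {R : Type u} {A : Type v} [CommRing R] [Ring A] [Algebra R A]
  {D : CellDatum.{u, v, w, x} R A} {M : Type y} [AddCommGroup M] [Module Aᵐᵒᵖ M]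
  (Φ : D.CellFiltration M)

theorem monotone_N : Monotone Φ.N := Fin.monotone_iff_le_succ.2 Φ.N_le

/-- The projection of the `(j+1)`-st term of a cell filtration onto its `j`-th layer, which is the
cell module `Δ(label j)`. -/
noncomputable def proj (j : Fin Φ.len) : ↥(Φ.N j.succ) →ₗ[Aᵐᵒᵖ] D.CellModule (Φ.label j) :=
  (Φ.iso j).toLinearMap ∘ₗ Submodule.mkQ _

theorem proj_eq_zero_iff (j : Fin Φ.len) (z : Φ.N j.succ) :
    Φ.proj j z = 0 ↔ (z : M) ∈ Φ.N j.castSucc := by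
  rw [proj, LinearMap.comp_apply, LinearEquiv.coe_coe, LinearEquiv.map_eq_zero_iff,
    Submodule.mkQ_apply, Submodule.Quotient.mk_eq_zero]
  rfl

theorem proj_surjective (j : Fin Φ.len) : Function.Surjective (Φ.proj j) :=
  (Φ.iso j).surjective.comp (Submodule.mkQ_surjective _)

/-- An element killing every layer of a cell filtration acts nilpotently. -/
theorem smul_pow_eq_zero {a : A}
    (ha : ∀ (j : Fin Φ.len) (z : D.CellModule (Φ.label j)), z <• a = 0) (z : M) :
    z <• a ^ Φ.len = 0 := by
  have key : ∀ j : Fin (Φ.len + 1), ∀ z ∈ Φ.N j, z <• a ^ (j : ℕ) = 0 := by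
    intro j
    induction j using Fin.induction with
    | zero =>
      intro z hz
      rw [Φ.N_zero, Submodule.mem_bot] at hz
      rw [hz, smul_zero]
    | succ j ih =>
      intro z hz
      have h1 : Φ.proj j (MulOpposite.op a • ⟨z, hz⟩) = 0 := by rw [map_smul, ha]
      have h2 := ih _ ((Φ.proj_eq_zero_iff j _).1 h1)
      rw [Submodule.coe_smul, smul_smul, ← MulOpposite.op_mul] at h2
      rwa [Fin.val_succ, pow_succ']
  exact key (Fin.last _) z (Φ.N_last ▸ Submodule.mem_top)

theorem layer_smul_eq_zero {a : A} (ha : ∀ z : M, z <• a = 0) (j : Fin Φ.len)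
    (z : D.CellModule (Φ.label j)) : z <• a = 0 := by
  obtain ⟨z, rfl⟩ := Φ.proj_surjective j z
  rw [← map_smul, Φ.proj_eq_zero_iff, Submodule.coe_smul, ha]
  exact zero_mem _

/-- Over the field of fractions the layers of two cell filtrations of the same module agree, because
the idempotent of the block of `lam` is the difference of the identity elements of `A^{⊵ lam}` and
`A^{▷ lam}`.  The element `e (e' - ρ')` is that idempotent up to a scalar: it kills every cell module
except `Δ(lam)`, on which it acts by a nonzero scalar. -/
theorem exists_label_eq {F : Type*} [IsDomain R] [Field F] [Algebra R F] [IsFractionRing R F]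
    (hss : IsSplitSemisimple F (F ⊗[R] A)) (Ψ : D.CellFiltration M) (j : Fin Ψ.len)
    (hne : Nonempty (D.Tab (Ψ.label j))) : ∃ i, Φ.label i = Ψ.label j := by
  by_contra! hcon
  set lam := Ψ.label j with hlam
  obtain ⟨e, he, ρ, hρ, hre⟩ := D.exists_rightIdentity hss (isUpperSet_Ici lam)
  obtain ⟨e', he', ρ', hρ', hre'⟩ := D.exists_rightIdentity hss (isUpperSet_Ioi lam)
  have hsmul : ∀ {nu : D.Λ} (z : D.CellModule nu),
      z <• (e * (e' - algebraMap R A ρ')) = (z <• e) <• e' - ρ' • (z <• e) := fun z => by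
    rw [MulOpposite.op_mul, mul_smul, MulOpposite.op_sub, sub_smul, ← MulOpposite.algebraMap_apply,
      algebraMap_smul]
  have hkill := Φ.smul_pow_eq_zero (a := e * (e' - algebraMap R A ρ')) fun i z => by
    rw [hsmul]
    by_cases hi : lam ≤ Φ.label i
    · rw [D.cellModule_smul_eq_smul (U := Set.Ioi lam) (lt_of_le_of_ne hi (hcon i).symm) hre',
        sub_self]
    · rw [D.cellModule_smul_eq_zero (isUpperSet_Ici lam) hi he]
      simp
  have hlayer : ∀ z : D.CellModule lam, z <• (e * (e' - algebraMap R A ρ')) = -(ρ' * ρ) • z :=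
    fun z => by
      rw [hsmul, D.cellModule_smul_eq_smul (U := Set.Ici lam) (Set.mem_Ici.2 le_rfl) hre,
        D.cellModule_smul_eq_zero (isUpperSet_Ioi lam) (lt_irrefl lam) he', zero_sub,
        smul_smul, neg_smul]
  have hpow : ∀ (n : ℕ) (z : D.CellModule lam),
      z <• (e * (e' - algebraMap R A ρ')) ^ n = (-(ρ' * ρ)) ^ n • z := by
    intro n
    induction n with
    | zero => intro z; simp
    | succ n ih =>
      intro z
      rw [pow_succ, MulOpposite.op_mul, mul_smul, ih, hlayer, smul_smul, pow_succ']
  have h0 := D.smul_cellModule_eq_zero (pow_ne_zero _ (neg_ne_zero.2 (mul_ne_zero hρ' hρ)))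
    ((hpow _ _).symm.trans (Ψ.layer_smul_eq_zero hkill j (fun _ => 1 : D.Tab lam → R)))
  obtain ⟨t⟩ := hne
  exact one_ne_zero (congrFun h0 t)

section Basis

variable [Module R M] [IsScalarTower R Aᵐᵒᵖ M] {κ : Fin Φ.len → Type*}
  (b : ∀ j, κ j → M) (hb : ∀ j i, b j i ∈ Φ.N j.succ)
  (B : ∀ j, Module.Basis (κ j) R (D.CellModule (Φ.label j)))
  (hB : ∀ j i, Φ.proj j ⟨b j i, hb j i⟩ = B j i)

include hB

theorem linearIndependent_of_layers [∀ j, Fintype (κ j)] :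
    LinearIndependent R fun i : Σ j, κ j => b i.1 i.2 := by
  rw [Fintype.linearIndependent_iff]
  rintro g hg ⟨j, i⟩
  revert i
  induction j using WellFoundedGT.induction with
  | ind j ih =>
    have hsum : ∑ i, g ⟨j, i⟩ • b j i ∈ (Φ.N j.castSucc).restrictScalars R := by
      rw [Fintype.sum_sigma, ← Finset.add_sum_erase _ _ (Finset.mem_univ j)] at hg
      rw [eq_neg_of_add_eq_zero_left hg]
      refine neg_mem (sum_mem fun j' hj' => sum_mem fun i _ => ?_)
      rcases lt_or_gt_of_ne (Finset.ne_of_mem_erase hj') with h | h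
      · exact Submodule.smul_mem _ _ (Φ.monotone_N (Fin.succ_le_castSucc_iff.2 h) (hb j' i))
      · rw [ih j' h, zero_smul]
        exact zero_mem _
    have hz : Φ.proj j (∑ i, g ⟨j, i⟩ • (⟨b j i, hb j i⟩ : Φ.N j.succ)) = 0 := by
      rw [Φ.proj_eq_zero_iff]
      simpa using hsum
    have hz' : ∑ i, g ⟨j, i⟩ • B j i = 0 := by
      rw [← hz, map_sum]
      refine Finset.sum_congr rfl fun i _ => ?_
      rw [← hB, LinearMap.map_smul_of_tower]
    exact Fintype.linearIndependent_iff.1 (B j).linearIndependent _ hz'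

theorem top_le_span_of_layers :
    ⊤ ≤ Submodule.span R (Set.range fun i : Σ j, κ j => b i.1 i.2) := by
  have key : ∀ j : Fin (Φ.len + 1), ∀ z ∈ Φ.N j,
      z ∈ Submodule.span R (Set.range fun i : Σ j, κ j => b i.1 i.2) := by
    intro j
    induction j using Fin.induction with
    | zero =>
      intro z hz
      rw [Φ.N_zero, Submodule.mem_bot] at hz
      rw [hz]
      exact zero_mem _
    | succ j ih =>
      intro z hz
      let c := (B j).repr (Φ.proj j ⟨z, hz⟩)
      let s : Φ.N j.succ := c.sum fun i r => r • (⟨b j i, hb j i⟩ : Φ.N j.succ)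
      have hs : Φ.proj j s = Φ.proj j ⟨z, hz⟩ := by
        rw [← (B j).linearCombination_repr (Φ.proj j ⟨z, hz⟩), Finsupp.linearCombination_apply]
        simp only [s, Finsupp.sum, map_sum]
        refine Finset.sum_congr rfl fun i _ => ?_
        rw [← hB, LinearMap.map_smul_of_tower]
      have h1 : z - s ∈ Φ.N j.castSucc := by
        have : Φ.proj j (⟨z, hz⟩ - s) = 0 := by rw [map_sub, hs, sub_self]
        exact (Φ.proj_eq_zero_iff j _).1 this
      have h2 : (s : M) ∈ Submodule.span R (Set.range fun i : Σ j, κ j => b i.1 i.2) := by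
        simp only [s, Finsupp.sum, Submodule.coe_sum, Submodule.coe_smul_of_tower]
        exact sum_mem fun i _ => Submodule.smul_mem _ _ (Submodule.subset_span ⟨⟨j, i⟩, rfl⟩)
      simpa using add_mem (ih _ h1) h2
  exact fun z _ => key (Fin.last _) z (Φ.N_last ▸ Submodule.mem_top)

end Basis

end CellDatum.CellFiltration

/-! ### Restriction and paths -/

namespace CellularTower

variable {R : Type u} {B : Type v} [CommRing R] [Ring B] [Algebra R B]
  (T : CellularTower.{u, v, w, x} R B)

noncomputable instance (r : ℕ) (mu : T.Λ (r + 1)) : Module R (T.Res r mu) :=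
  inferInstanceAs (Module R (T.Δ (r + 1) mu))

theorem toRes_smul {r : ℕ} {mu : T.Λ (r + 1)} (z : T.Δ (r + 1) mu) (a : T.A r) :
    T.toRes r mu z <• a = T.toRes r mu (z <• T.incl r.le_succ a) := rfl

instance (r : ℕ) (mu : T.Λ (r + 1)) : IsScalarTower R (T.A r)ᵐᵒᵖ (T.Res r mu) where
  smul_assoc c a z := by
    have h (z : T.Δ (r + 1) mu) :
        z <• T.incl r.le_succ (c • a.unop) = c • (z <• T.incl r.le_succ a.unop) := by
      rw [map_smul, MulOpposite.op_smul, smul_assoc]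
    exact h z

theorem incl_incl {k l r : ℕ} (h : k ≤ l) (h' : l ≤ r) (a : T.A k) :
    T.incl h' (T.incl h a) = T.incl (h.trans h') a := rfl

theorem incl_self {r : ℕ} (a : T.A r) : T.incl le_rfl a = a := rfl

variable {T}

/-- The first `r` steps of a path of length `r + 1`. -/
def Path.init {r : ℕ} (t : T.Path (r + 1)) : T.Path r where
  vertex k h := t.vertex k (h.trans r.le_succ)
  edge k h := t.edge k (h.trans r.le_succ)

theorem Path.ext_init {r : ℕ} {s t : T.Path (r + 1)} (h : s.init = t.init)
    (hr : s.vertex (r + 1) le_rfl = t.vertex (r + 1) le_rfl) : s = t := by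
  refine Path.ext (funext fun k => funext fun hk => ?_)
  rcases Nat.lt_or_ge r k with hk' | hk'
  · obtain rfl : k = r + 1 := by omega
    exact hr
  · exact congrFun (congrFun (congrArg Path.vertex h) k) hk'

theorem Path.exists_init_eq {r : ℕ} (s : T.Path r) {mu : T.Λ (r + 1)}
    (h : T.Edge (s.vertex r le_rfl) mu) :
    ∃ t : T.Path (r + 1), t.init = s ∧ t.vertex (r + 1) le_rfl = mu := by
  let f : ∀ k, k ≤ r + 1 → T.Λ k := fun k hk =>
    if hkr : k ≤ r then s.vertex k hkr else (show r + 1 = k by omega) ▸ mu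
  have hf : ∀ k (hk : k ≤ r), f k (hk.trans r.le_succ) = s.vertex k hk := fun k hk => dif_pos hk
  have hf' : f (r + 1) le_rfl = mu := dif_neg (by omega)
  refine ⟨⟨f, fun k hk => ?_⟩, Path.ext (funext fun k => funext fun hk => hf k hk), hf'⟩
  rcases Nat.lt_or_ge k r with hkr | hkr
  · rw [hf k hkr.le, hf (k + 1) hkr]
    exact s.edge k hkr
  · obtain rfl : k = r := by omega
    rw [hf k le_rfl, hf']
    exact h

end CellularTower

namespace CellularTower

variable {R : Type u} {B : Type v} [CommRing R] [Ring B] [Algebra R B]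
  {T : CellularTower.{u, v, w, x} R B}

/-- The path in `Std_{r+1}(mu)` obtained from a path in `Std_r(lam)` by adding the edge
`lam → mu`. -/
noncomputable def Std.extend {r : ℕ} {lam : T.Λ r} {mu : T.Λ (r + 1)} (s : T.Std r lam)
    (h : T.Edge lam mu) : T.Std (r + 1) mu :=
  ⟨(s.1.exists_init_eq (s.2.symm ▸ h)).choose, (s.1.exists_init_eq (s.2.symm ▸ h)).choose_spec.2⟩

theorem Std.init_extend {r : ℕ} {lam : T.Λ r} {mu : T.Λ (r + 1)} (s : T.Std r lam)
    (h : T.Edge lam mu) : (s.extend h).1.init = s.1 :=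
  (s.1.exists_init_eq (s.2.symm ▸ h)).choose_spec.1

theorem Std.vertex_extend {r : ℕ} {lam : T.Λ r} {mu : T.Λ (r + 1)} (s : T.Std r lam)
    (h : T.Edge lam mu) {k : ℕ} (hk : k ≤ r) :
    (s.extend h).1.vertex k (hk.trans r.le_succ) = s.1.vertex k hk :=
  congrFun (congrFun (congrArg Path.vertex (s.init_extend h)) k) hk

instance (lam : T.Λ 0) : Nonempty (T.Std 0 lam) :=
  ⟨⟨⟨fun _ hk => (Nat.le_zero.1 hk).symm ▸ lam, fun _ h => absurd h (by omega)⟩, rfl⟩⟩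

instance (lam : T.Λ 0) : Subsingleton (T.Std 0 lam) := by
  refine ⟨fun s t => Subtype.ext (Path.ext (funext fun k => funext fun hk => ?_))⟩
  obtain rfl := Nat.le_zero.1 hk
  exact s.2.trans t.2.symm

end CellularTower

namespace DiagramStructure

/-! ### Generators and branching factors -/

section Generators

variable {R : Type u} {F : Type y} {B : Type v} [CommRing R] [Field F]
  [Algebra R F] [Ring B] [Algebra R B] {T : CellularTower.{u, v, w, x} R B}
  (S : DiagramStructure F T)

theorem δ_ne_zero [Nontrivial R] (r : ℕ) (lam : T.Λ r) : S.δ r lam ≠ 0 := by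
  intro h
  have hc := S.cyclic r lam
  rw [h, Submodule.span_zero_singleton] at hc
  obtain ⟨t⟩ := S.tab_nonempty r lam
  have hz : ∀ z : T.Δ r lam, z = 0 := fun z => (Submodule.mem_bot _).1 (hc ▸ Submodule.mem_top)
  have h1 : (fun _ => 1 : (T.cell r).Tab lam → R) = fun _ => 0 := hz _
  exact one_ne_zero (congrFun h1 t)

/-- The right modules `(m_lam A + A^{▷ lam}) / A^{▷ lam}` and `Δ(lam)` are identified by sending the
class of `m_lam` to `δ(lam)`. -/
theorem δ_smul_eq_zero_iff [IsDomain R] {r : ℕ} {lam : T.Λ r} (a : T.A r) :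
    S.δ r lam <• a = 0 ↔ S.m r lam * a ∈ (T.cell r).idealGT lam := by
  have h := S.α_bimodule r lam 1 a ⟨S.m r lam, S.m_mem r lam⟩
  rw [S.α_m, TensorProduct.map_tmul, CellDatum.inv_one, CellDatum.act_apply, CellDatum.act_apply,
    MulOpposite.op_one, one_smul] at h
  simp only [one_mul] at h
  constructor
  · intro h0
    rw [h0, TensorProduct.tmul_zero, LinearEquiv.map_eq_zero_iff,
      Submodule.Quotient.mk_eq_zero] at h
    exact h
  · intro h0
    refine (T.cell r).eq_zero_of_tmul_eq_zero (S.δ_ne_zero r lam) ?_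
    rw [← h, LinearEquiv.map_eq_zero_iff, Submodule.Quotient.mk_eq_zero]
    exact h0

/-- Iterating `m_mu d_{lam → mu} = u^* m_lam` along a path. -/
theorem exists_m_mul_dPrefix_eq {r : ℕ} (t : T.Path r) {k l : ℕ} (hkl : k ≤ l) (hl : l ≤ r) :
    ∃ z : T.A l, S.m l (t.vertex l hl) * S.dPrefix t l hl =
      z * T.incl hkl (S.m k (t.vertex k (hkl.trans hl)) * S.dPrefix t k (hkl.trans hl)) := by
  induction l, hkl using Nat.le_induction with
  | base => exact ⟨1, (one_mul _).symm⟩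
  | succ l hkl ih =>
    obtain ⟨z, hz⟩ := ih (l.le_succ.trans hl)
    obtain ⟨u, hu⟩ := S.compat l _ _ (t.edge l hl)
    refine ⟨(T.cell (l + 1)).inv u * T.incl l.le_succ z, ?_⟩
    rw [dPrefix, ← mul_assoc, hu, mul_assoc, ← map_mul, hz, map_mul, T.incl_incl, mul_assoc]

theorem dPrefix_init {r : ℕ} (t : T.Path (r + 1)) {k : ℕ} (hk : k ≤ r) :
    S.dPrefix t.init k hk = S.dPrefix t k (hk.trans r.le_succ) := by
  induction k with
  | zero => rfl
  | succ k ih => rw [dPrefix, dPrefix, ih]; rfl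

theorem murphy_zero {lam : T.Λ 0} (t : T.Std 0 lam) : S.murphy t = S.δ 0 lam := one_smul _ _

theorem murphy_extend {r : ℕ} {lam : T.Λ r} {mu : T.Λ (r + 1)} (s : T.Std r lam)
    (h : T.Edge lam mu) : S.murphy (s.extend h) =
      (S.δ (r + 1) mu <• S.d r lam mu) <• T.incl r.le_succ (S.dPath s.1) := by
  have h1 : S.dPath (s.extend h).1 = S.d r lam mu * T.incl r.le_succ (S.dPath s.1) := by
    rw [dPath, dPrefix, ← dPrefix_init, s.init_extend, (s.extend h).2,
      s.vertex_extend h le_rfl, s.2]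
    rfl
  rw [murphy, h1, MulOpposite.op_mul, mul_smul]

/-- If `m_{t(k)} d_{t(0) → ⋯ → t(k)} a` lies in the ideal of `A_k` attached to `U`, then an element
acting on this ideal from the right as `ρ` acts on `m_t a` as `ρ`. -/
theorem murphy_smul_smul_eq [IsDomain R] {r : ℕ} {lam : T.Λ r} (t : T.Std r lam) {k : ℕ}
    (hk : k ≤ r) {U : Set (T.Λ k)} {a : T.A k}
    (ha : S.m k (t.1.vertex k hk) * S.dPrefix t.1 k hk * a ∈ (T.cell k).upperIdeal U)
    {e : T.A k} {ρ : R} (he : ∀ b ∈ (T.cell k).upperIdeal U, b * e = ρ • b) :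
    (S.murphy t <• T.incl hk a) <• T.incl hk e = ρ • (S.murphy t <• T.incl hk a) := by
  obtain ⟨z, hz⟩ := S.exists_m_mul_dPrefix_eq t.1 hk le_rfl
  rw [t.2] at hz
  have h1 : S.m r lam * (S.dPath t.1 * T.incl hk a * T.incl hk e -
      ρ • (S.dPath t.1 * T.incl hk a)) = 0 := by
    rw [mul_sub, mul_smul_comm, ← mul_assoc, ← mul_assoc, dPath, hz, mul_assoc z, ← map_mul,
      mul_assoc z, ← map_mul, he _ ha, map_smul, mul_smul_comm, sub_self]
  have h2 := (S.δ_smul_eq_zero_iff _).2 (h1 ▸ zero_mem _)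
  rw [MulOpposite.op_sub, sub_smul, sub_eq_zero, MulOpposite.op_smul, smul_assoc,
    MulOpposite.op_mul, mul_smul, MulOpposite.op_mul, mul_smul] at h2
  exact h2

theorem m_mul_mem_upperIdeal {r : ℕ} {lam : T.Λ r} {U : Set (T.Λ r)} (hU : IsUpperSet U)
    (h : lam ∈ U) (a : T.A r) : S.m r lam * a ∈ (T.cell r).upperIdeal U :=
  (T.cell r).mul_right_mem_upperIdeal hU
    ((T.cell r).idealGE_le_upperIdeal hU h (S.m_mem r lam)) a

theorem murphy_smul_eq [IsDomain R] {r : ℕ} {lam : T.Λ r} (t : T.Std r lam) {k : ℕ}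
    (hk : k ≤ r) {U : Set (T.Λ k)} (hU : IsUpperSet U) (ht : t.1.vertex k hk ∈ U)
    {e : T.A k} {ρ : R} (he : ∀ b ∈ (T.cell k).upperIdeal U, b * e = ρ • b) :
    S.murphy t <• T.incl hk e = ρ • S.murphy t := by
  have h := S.murphy_smul_smul_eq t hk (a := 1)
    (by rw [mul_one]; exact S.m_mul_mem_upperIdeal hU ht _) he
  simpa using h

/-- A cell filtration of the restriction of `Δ_{r+1}(mu)` to `A_r` giving rise to the branching
factors. -/
noncomputable def filtration (r : ℕ) (mu : T.Λ (r + 1)) :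
    (T.cell r).CellFiltration (T.Res r mu) :=
  (S.d_spec r mu).choose

theorem edge_label {r : ℕ} {mu : T.Λ (r + 1)} (j : Fin (S.filtration r mu).len) :
    T.Edge ((S.filtration r mu).label j) mu := ⟨_, j, rfl⟩

theorem proj_murphy_extend {r : ℕ} {mu : T.Λ (r + 1)} (j : Fin (S.filtration r mu).len)
    (s : T.Std r ((S.filtration r mu).label j)) :
    ∃ h : T.toRes r mu (S.murphy (s.extend (S.edge_label j))) ∈ (S.filtration r mu).N j.succ,
      (S.filtration r mu).proj j ⟨_, h⟩ = S.murphy s := by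
  obtain ⟨h, hj⟩ := (S.d_spec r mu).choose_spec j
  have hm := congrArg (T.toRes r mu) (S.murphy_extend s (S.edge_label j))
  rw [← T.toRes_smul] at hm
  rw [hm]
  refine ⟨Submodule.smul_mem _ _ h, ?_⟩
  have := (S.filtration r mu).proj j |>.map_smul (MulOpposite.op (S.dPath s.1)) ⟨_, h⟩
  exact this.trans (congrArg (MulOpposite.op (S.dPath s.1) • ·) hj)

end Generators

/-! ### The Murphy basis -/

section MurphyBasis

variable {R : Type u} {F : Type y} {B : Type v} [CommRing R] [IsDomain R] [Field F]
  [Algebra R F] [IsFractionRing R F] [Ring B] [Algebra R B] {T : CellularTower.{u, v, w, x} R B}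
  (S : DiagramStructure F T)

/-- Every path in `Std_{r+1}(mu)` is, in a unique way, an extension of a path ending at the label of
a layer of any given cell filtration. -/
theorem bijective_extend {r : ℕ} (mu : T.Λ (r + 1)) :
    Function.Bijective fun i : Σ j, T.Std r ((S.filtration r mu).label j) =>
      i.2.extend (S.edge_label i.1) := by
  constructor
  · rintro ⟨j, s⟩ ⟨j', s'⟩ h
    have h1 : s.1 = s'.1 := by
      rw [← s.init_extend (S.edge_label j), ← s'.init_extend (S.edge_label j')]
      exact congrArg (fun t : T.Std (r + 1) mu => t.1.init) h
    obtain rfl : j = j' := (S.filtration r mu).label_anti.injective (by rw [← s.2, ← s'.2, h1])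
    exact congrArg (Sigma.mk j) (Subtype.ext h1)
  · intro t
    obtain ⟨Ψ, j, hj⟩ : T.Edge (t.1.init.vertex r le_rfl) mu := by
      have := t.1.edge r le_rfl
      rwa [t.2] at this
    obtain ⟨i, hi⟩ := (S.filtration r mu).exists_label_eq (S.split_semisimple r) Ψ j
      (S.tab_nonempty r _)
    refine ⟨⟨i, t.1.init, (hi.trans hj).symm⟩, Subtype.ext (CellularTower.Path.ext_init ?_ ?_)⟩
    · exact CellularTower.Std.init_extend _ _
    · exact (CellularTower.Std.extend _ _).2.trans t.2.symm

theorem linearIndependent_murphy_and_top_le_span (r : ℕ) (lam : T.Λ r) :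
    LinearIndependent R (S.murphy (lam := lam)) ∧
      ⊤ ≤ Submodule.span R (Set.range (S.murphy (lam := lam))) := by
  induction r with
  | zero =>
    obtain ⟨t⟩ := (inferInstance : Nonempty (T.Std 0 lam))
    constructor
    · rw [Fintype.linearIndependent_iff]
      intro g hg s
      by_contra h0
      rw [Fintype.sum_subsingleton _ s] at hg
      exact S.δ_ne_zero 0 lam ((T.cell 0).smul_cellModule_eq_zero h0 (S.murphy_zero s ▸ hg))
    · intro z _
      have hz : z ∈ Submodule.span (T.A 0)ᵐᵒᵖ {S.δ 0 lam} := S.cyclic 0 lam ▸ Submodule.mem_top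
      obtain ⟨a, rfl⟩ := Submodule.mem_span_singleton.1 hz
      obtain ⟨c, hc⟩ := S.zero_eq.2 a.unop
      have ha : a = algebraMap R (T.A 0)ᵐᵒᵖ c := by
        rw [MulOpposite.algebraMap_apply, hc, MulOpposite.op_unop]
      rw [ha, algebraMap_smul, ← S.murphy_zero t]
      exact Submodule.smul_mem _ _ (Submodule.subset_span ⟨t, rfl⟩)
  | succ r ih =>
    let Φ := S.filtration r lam
    let b : ∀ j, T.Std r (Φ.label j) → T.Res r lam := fun j s =>
      T.toRes r lam (S.murphy (s.extend (S.edge_label j)))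
    have hb : ∀ j s, b j s ∈ Φ.N j.succ := fun j s => (S.proj_murphy_extend j s).choose
    let Bs : ∀ j, Module.Basis (T.Std r (Φ.label j)) R (T.Δ r (Φ.label j)) := fun j =>
      Module.Basis.mk (ih (Φ.label j)).1 (ih (Φ.label j)).2
    have hB : ∀ j s, Φ.proj j ⟨b j s, hb j s⟩ = Bs j s := fun j s =>
      (S.proj_murphy_extend j s).choose_spec.trans (Module.Basis.mk_apply _ _ s).symm
    let φ := Equiv.ofBijective _ (S.bijective_extend lam)
    constructor
    · exact (linearIndependent_equiv φ).1 (Φ.linearIndependent_of_layers b hb Bs hB)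
    · rw [← φ.surjective.range_comp]
      exact Φ.top_le_span_of_layers b hb Bs hB

/-- The Murphy basis of `Δ_r(lam)`. -/
noncomputable def murphyBasis (r : ℕ) (lam : T.Λ r) : Module.Basis (T.Std r lam) R (T.Δ r lam) :=
  Module.Basis.mk (S.linearIndependent_murphy_and_top_le_span r lam).1
    (S.linearIndependent_murphy_and_top_le_span r lam).2

theorem murphyBasis_apply {r : ℕ} {lam : T.Λ r} (t : T.Std r lam) :
    S.murphyBasis r lam t = S.murphy t := Module.Basis.mk_apply _ _ t

open Classical in
theorem repr_murphy {r : ℕ} {lam : T.Λ r} (s t : T.Std r lam) :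
    (S.murphyBasis r lam).repr (S.murphy s) t = if s = t then 1 else 0 := by
  rw [← S.murphyBasis_apply, Module.Basis.repr_self, Finsupp.single_apply]

/-- Subtracting the lift of its image in the `j`-th layer moves an element of the `(j+1)`-st term of
the cell filtration to the `j`-th term. -/
theorem sub_sum_murphy_extend_mem {r : ℕ} {mu : T.Λ (r + 1)} (j : Fin (S.filtration r mu).len)
    (z : T.Δ (r + 1) mu) (hz : T.toRes r mu z ∈ (S.filtration r mu).N j.succ) :
    T.toRes r mu (z - ∑ s, (S.murphyBasis r _).repr ((S.filtration r mu).proj j ⟨_, hz⟩) s •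
      S.murphy (s.extend (S.edge_label j))) ∈ (S.filtration r mu).N j.castSucc := by
  have hm := fun s => S.proj_murphy_extend j s
  choose hm hmp using hm
  have hproj : (S.filtration r mu).proj j (⟨_, hz⟩ -
      ∑ s, (S.murphyBasis r _).repr ((S.filtration r mu).proj j ⟨_, hz⟩) s • ⟨_, hm s⟩) = 0 := by
    rw [map_sub, sub_eq_zero, map_sum]
    refine ((S.murphyBasis r _).sum_repr ((S.filtration r mu).proj j ⟨_, hz⟩)).symm.trans ?_
    refine Finset.sum_congr rfl fun s _ => ?_
    rw [LinearMap.map_smul_of_tower, murphyBasis_apply, hmp]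
  have h := ((S.filtration r mu).proj_eq_zero_iff j _).1 hproj
  rw [Submodule.coe_sub, Submodule.coe_sum] at h
  exact h

/-- The step of `repr_smul_eq_zero` along one layer of the cell filtration: modulo the previous term,
`z a` agrees with a combination of elements `m_t` with `t(k) ∈ U`.  Acting by an element `e` of the
ideal with `a e = ρ a` and `m_t e = ρ m_t` moves the error term into the image of the previous term
under the ideal. -/
theorem repr_smul_eq_zero_of_layer {r : ℕ} {mu : T.Λ (r + 1)} {k : ℕ} (hk : k ≤ r)
    {U : Set (T.Λ k)} (hU : IsUpperSet U) (j : Fin (S.filtration r mu).len)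
    (hlayer : ∀ a ∈ (T.cell k).upperIdeal U, ∀ (y : T.Δ r ((S.filtration r mu).label j)) s,
      s.1.vertex k hk ∉ U → (S.murphyBasis r _).repr (y <• T.incl hk a) s = 0)
    (hprev : ∀ z : T.Δ (r + 1) mu, T.toRes r mu z ∈ (S.filtration r mu).N j.castSucc →
      ∀ a ∈ (T.cell k).upperIdeal U, ∀ t : T.Std (r + 1) mu,
        t.1.vertex k (hk.trans r.le_succ) ∉ U →
        (S.murphyBasis (r + 1) mu).repr (z <• T.incl (hk.trans r.le_succ) a) t = 0)
    (z : T.Δ (r + 1) mu) (hz : T.toRes r mu z ∈ (S.filtration r mu).N j.succ) {a : T.A k}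
    (ha : a ∈ (T.cell k).upperIdeal U) {t : T.Std (r + 1) mu}
    (ht : t.1.vertex k (hk.trans r.le_succ) ∉ U) :
    (S.murphyBasis (r + 1) mu).repr (z <• T.incl (hk.trans r.le_succ) a) t = 0 := by
  classical
  obtain ⟨e, he, ρ, hρ, hre⟩ := (T.cell k).exists_rightIdentity (S.split_semisimple k) hU
  have hza : T.toRes r mu (z <• T.incl (hk.trans r.le_succ) a) ∈ (S.filtration r mu).N j.succ :=
    Submodule.smul_mem _ (MulOpposite.op (T.incl hk a)) hz
  have hw := S.sub_sum_murphy_extend_mem j _ hza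
  have hc : ∀ s, s.1.vertex k hk ∉ U →
      (S.murphyBasis r _).repr ((S.filtration r mu).proj j ⟨_, hza⟩) s = 0 := fun s hs => by
    rw [← hlayer a ha ((S.filtration r mu).proj j ⟨_, hz⟩) s hs]
    exact congrArg (fun y => (S.murphyBasis r _).repr y s)
      (((S.filtration r mu).proj j).map_smul (MulOpposite.op (T.incl hk a)) ⟨_, hz⟩)
  generalize (S.murphyBasis r _).repr ((S.filtration r mu).proj j ⟨_, hza⟩) = c at hw hc
  set g : T.Δ (r + 1) mu := ∑ s, c s • S.murphy (s.extend (S.edge_label j)) with hg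
  have hgt : (S.murphyBasis (r + 1) mu).repr g t = 0 := by
    simp only [hg, map_sum, map_smul, Finsupp.finsetSum_apply, Finsupp.smul_apply, repr_murphy]
    refine Finset.sum_eq_zero fun s _ => ?_
    split_ifs with h
    · rw [hc s (by rwa [← s.vertex_extend (S.edge_label j), h]), zero_smul]
    · exact smul_zero _
  have hge : g <• T.incl (hk.trans r.le_succ) e = ρ • g := by
    simp only [hg, Finset.smul_sum]
    refine Finset.sum_congr rfl fun s _ => ?_
    by_cases hs : s.1.vertex k hk ∈ U
    · rw [smul_comm, S.murphy_smul_eq _ _ hU (by rwa [s.vertex_extend _ hk]) hre, smul_comm]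
    · rw [hc s hs, zero_smul, smul_zero, smul_zero]
  have hwe := hprev _ hw e he t ht
  rw [smul_sub, hge, smul_smul, ← MulOpposite.op_mul, ← map_mul, hre a ha, map_smul,
    MulOpposite.op_smul, smul_assoc, ← smul_sub, map_smul, Finsupp.smul_apply, map_sub,
    Finsupp.sub_apply, hgt, sub_zero] at hwe
  exact (mul_eq_zero.1 hwe).resolve_left hρ

/-- The image of `Δ_r(lam)` under the ideal of `A_k` attached to an upper set `U` lies in the span
of the Murphy basis elements `m_t` with `t(k) ∈ U`. -/
theorem repr_smul_eq_zero {r : ℕ} {lam : T.Λ r} {k : ℕ} (hk : k ≤ r) {U : Set (T.Λ k)}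
    (hU : IsUpperSet U) {a : T.A k} (ha : a ∈ (T.cell k).upperIdeal U) (z : T.Δ r lam)
    {t : T.Std r lam} (ht : t.1.vertex k hk ∉ U) :
    (S.murphyBasis r lam).repr (z <• T.incl hk a) t = 0 := by
  induction r, hk using Nat.le_induction generalizing a with
  | base =>
    rw [t.2] at ht
    rw [T.incl_self, (T.cell _).cellModule_smul_eq_zero hU ht ha, map_zero, Finsupp.zero_apply]
  | succ r hk ih =>
    have key : ∀ j : Fin ((S.filtration r lam).len + 1), ∀ z : T.Δ (r + 1) lam,
        T.toRes r lam z ∈ (S.filtration r lam).N j →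
        ∀ a ∈ (T.cell k).upperIdeal U, ∀ t : T.Std (r + 1) lam,
          t.1.vertex k (hk.trans r.le_succ) ∉ U →
          (S.murphyBasis (r + 1) lam).repr (z <• T.incl (hk.trans r.le_succ) a) t = 0 := by
      intro j
      induction j using Fin.induction with
      | zero =>
        intro z hz a _ t _
        rw [(S.filtration r lam).N_zero, Submodule.mem_bot] at hz
        obtain rfl : z = 0 := hz
        rw [smul_zero, map_zero, Finsupp.zero_apply]
      | succ j ihj =>
        intro z hz a ha t ht
        exact S.repr_smul_eq_zero_of_layer hk hU j (fun a ha y s hs => ih ha y hs) ihj z hz ha ht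
    exact key (Fin.last _) z ((S.filtration r lam).N_last ▸ Submodule.mem_top) a ha t ht

end MurphyBasis

end DiagramStructure

/-! ### Triangularity of the Jucys--Murphy elements -/

namespace CellularTower

section JucysMurphy

variable {R : Type u} {B : Type v} [CommRing R] [Ring B] [Algebra R B]
  {T : CellularTower.{u, v, w, x} R B} {L : ∀ r, T.A r} {e : ∀ r, T.Λ r → R}

variable (L) in
/-- The element `L 1 + ⋯ + L r` of `A r`. -/
def jmSum (r : ℕ) : T.A r := ∑ i : Fin r, T.incl (Nat.succ_le_of_lt i.2) (L (i + 1))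

variable (L) in
/-- The element `L 1 ⋯ L r` of `A r`. -/
def jmProd (r : ℕ) : T.A r :=
  (List.ofFn fun i : Fin r => T.incl (Nat.succ_le_of_lt i.2) (L (i + 1))).prod

theorem jmSum_succ (r : ℕ) : jmSum L (r + 1) = T.incl r.le_succ (jmSum L r) + L (r + 1) := by
  rw [jmSum, Fin.sum_univ_castSucc, jmSum, map_sum]
  rfl

theorem jmProd_succ (r : ℕ) : jmProd L (r + 1) = T.incl r.le_succ (jmProd L r) * L (r + 1) := by
  rw [jmProd, List.ofFn_succ', List.prod_concat, jmProd, map_list_prod, List.map_ofFn]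
  rfl

theorem IsAdditiveJM.smul_jmSum (h : T.IsAdditiveJM L e) (r : ℕ) (lam : T.Λ r) (z : T.Δ r lam) :
    z <• jmSum L r = e r lam • z := by
  rcases Nat.eq_zero_or_pos r with rfl | hr
  · simp [jmSum, h.scalar_zero]
  · exact h.scalar r hr lam z

theorem IsMultiplicativeJM.smul_jmProd (h : T.IsMultiplicativeJM L e) (r : ℕ) (lam : T.Λ r)
    (z : T.Δ r lam) : z <• jmProd L r = e r lam • z := by
  rcases Nat.eq_zero_or_pos r with rfl | hr
  · simp [jmProd, h.scalar_zero]
  · exact h.scalar r hr lam z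

theorem IsMultiplicativeJM.isUnit_jmProd (h : T.IsMultiplicativeJM L e) (r : ℕ) :
    IsUnit (jmProd L r) := by
  induction r with
  | zero => exact isUnit_one
  | succ r ih => rw [jmProd_succ]; exact (ih.map _).mul (h.isUnit _ (Nat.succ_pos r))

/-- An invertible element acting on a nonzero free module as a scalar acts as an invertible one. -/
theorem IsMultiplicativeJM.isUnit_scalar (h : T.IsMultiplicativeJM L e) {r : ℕ} {lam : T.Λ r}
    (hne : Nonempty ((T.cell r).Tab lam)) : IsUnit (e r lam) := by
  obtain ⟨t⟩ := hne
  obtain ⟨a, ha⟩ := (h.isUnit_jmProd r).exists_right_inv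
  have hz : ∀ z : T.Δ r lam, e r lam • (z <• a) = z := fun z => by
    rw [smul_comm, ← h.smul_jmProd, smul_smul, ← MulOpposite.op_mul, ha, MulOpposite.op_one,
      one_smul]
  exact IsUnit.of_mul_eq_one _ (congrFun (hz fun _ => 1 : _ = (fun _ => 1 : _ → R)) t)

end JucysMurphy

end CellularTower

namespace DiagramStructure

open CellularTower

variable {R : Type u} {F : Type y} {B : Type v} [CommRing R] [IsDomain R] [Field F]
  [Algebra R F] [IsFractionRing R F] [Ring B] [Algebra R B] {T : CellularTower.{u, v, w, x} R B}
  (S : DiagramStructure F T)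

/-- Right multiplication by an element of `A_{k+1}` commuting with `A_k` is triangular with respect
to the dominance order.  For every `j`, an element `e` of the ideal `A_j^{⊵ t(j)}` acts on `m_t` as a
nonzero scalar, and `e` either commutes with `a`, when `j ≤ k`, or absorbs it, when `k < j`.  So a
multiple of `m_t a` lies in the image of this ideal. -/
theorem repr_murphy_smul_eq_zero {r : ℕ} {lam : T.Λ r} {k : ℕ} (hk : k + 1 ≤ r) {a : T.A (k + 1)}
    (ha : ∀ b : T.A k, Commute a (T.incl k.le_succ b)) {s t : T.Std r lam}
    (h : ¬ s.1.Dominates t.1) :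
    (S.murphyBasis r lam).repr (S.murphy t <• T.incl hk a) s = 0 := by
  simp only [Path.Dominates, not_forall] at h
  obtain ⟨j, hj, hst⟩ := h
  have hU := isUpperSet_Ici (t.1.vertex j hj)
  obtain ⟨e, he, ρ, hρ, hre⟩ := (T.cell j).exists_rightIdentity (S.split_semisimple j) hU
  have hmt := S.murphy_smul_eq t hj hU (Set.mem_Ici.2 le_rfl) hre
  have hprod : ∃ (z : T.Δ r lam) (b : T.A j), b ∈ (T.cell j).upperIdeal (Set.Ici (t.1.vertex j hj)) ∧
      ρ • (S.murphy t <• T.incl hk a) = z <• T.incl hj b := by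
    rw [← smul_comm, ← hmt, smul_smul, ← MulOpposite.op_mul]
    rcases Nat.lt_or_ge k j with hkj | hkj
    · exact ⟨_, e * T.incl hkj a, (T.cell j).mul_right_mem_upperIdeal hU he _, by
        rw [map_mul]; rfl⟩
    · refine ⟨S.murphy t <• T.incl hk a, e, he, ?_⟩
      have hcomm := (ha (T.incl hkj e)).map (T.incl hk)
      rw [smul_smul, ← MulOpposite.op_mul]
      exact congrArg (fun b => S.murphy t <• b) hcomm.eq.symm
  obtain ⟨z, b, hb, hz⟩ := hprod
  have h0 := S.repr_smul_eq_zero hj hU hb z (t := s) hst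
  rw [← hz, map_smul, Finsupp.smul_apply] at h0
  exact (mul_eq_zero.1 h0).resolve_left hρ

/-- If `a` acts on `Δ_k(t(k))` as the scalar `c`, then `m_t a - c m_t` lies in the image of the ideal
`A_k^{▷ t(k)}`, up to a nonzero scalar. -/
theorem repr_murphy_smul_of_scalar {r : ℕ} {lam : T.Λ r} {k : ℕ} (hk : k ≤ r) {a : T.A k} {c : R}
    {s t : T.Std r lam} (ha : ∀ z : T.Δ k (t.1.vertex k hk), z <• a = c • z)
    (h : ¬ t.1.vertex k hk < s.1.vertex k hk) :
    (S.murphyBasis r lam).repr (S.murphy t <• T.incl hk a) s =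
      c * (S.murphyBasis r lam).repr (S.murphy t) s := by
  have hU := isUpperSet_Ioi (t.1.vertex k hk)
  obtain ⟨e, he, ρ, hρ, hre⟩ := (T.cell k).exists_rightIdentity (S.split_semisimple k) hU
  have hmem : S.m k (t.1.vertex k hk) * S.dPrefix t.1 k hk * (a - algebraMap R _ c) ∈
      (T.cell k).upperIdeal (Set.Ioi (t.1.vertex k hk)) := by
    rw [mul_assoc]
    refine (S.δ_smul_eq_zero_iff _).1 ?_
    rw [MulOpposite.op_mul, mul_smul, MulOpposite.op_sub, sub_smul, ha,
      ← MulOpposite.algebraMap_apply, algebraMap_smul, sub_self]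
  have h1 := S.murphy_smul_smul_eq t hk hmem hre
  have h0 := S.repr_smul_eq_zero hk hU he (S.murphy t <• T.incl hk (a - algebraMap R _ c)) (t := s) h
  rw [h1, map_smul, Finsupp.smul_apply] at h0
  have h2 := (mul_eq_zero.1 h0).resolve_left hρ
  rwa [map_sub, AlgHom.commutes, MulOpposite.op_sub, sub_smul, ← MulOpposite.algebraMap_apply,
    algebraMap_smul, map_sub, Finsupp.sub_apply, map_smul _ c, Finsupp.smul_apply, sub_eq_zero] at h2

theorem repr_murphy_smul_of_isAdditiveJM {L : ∀ r, T.A r} {e : ∀ r, T.Λ r → R}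
    (hL : T.IsAdditiveJM L e) {r : ℕ} {lam : T.Λ r} (t : T.Std r lam) {k : ℕ} (hk : k + 1 ≤ r) :
    (S.murphyBasis r lam).repr (S.murphy t <• T.incl hk (L (k + 1))) t =
      e (k + 1) (t.1.vertex (k + 1) hk) - e k (t.1.vertex k (k.le_succ.trans hk)) := by
  classical
  have h1 := S.repr_murphy_smul_of_scalar hk (s := t) (t := t) (hL.smul_jmSum _ _) (lt_irrefl _)
  have h2 := S.repr_murphy_smul_of_scalar (k.le_succ.trans hk) (s := t) (t := t)
    (hL.smul_jmSum _ _) (lt_irrefl _)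
  rw [S.repr_murphy, if_pos rfl, mul_one] at h1 h2
  rw [jmSum_succ, map_add, T.incl_incl, MulOpposite.op_add, add_smul, map_add, Finsupp.add_apply,
    h2] at h1
  rw [← h1, add_sub_cancel_left]

theorem repr_murphy_smul_of_isMultiplicativeJM {L : ∀ r, T.A r} {e : ∀ r, T.Λ r → R}
    (hL : T.IsMultiplicativeJM L e) {r : ℕ} {lam : T.Λ r} (t : T.Std r lam) {k : ℕ}
    (hk : k + 1 ≤ r) :
    (S.murphyBasis r lam).repr (S.murphy t <• T.incl hk (L (k + 1))) t *
      e k (t.1.vertex k (k.le_succ.trans hk)) = e (k + 1) (t.1.vertex (k + 1) hk) := by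
  classical
  have h1 := S.repr_murphy_smul_of_scalar hk (s := t) (t := t) (hL.smul_jmProd _ _) (lt_irrefl _)
  -- `L_{k+1}` is put first, so that triangularity of `L_1 ⋯ L_k` is not needed.
  rw [S.repr_murphy, if_pos rfl, mul_one, jmProd_succ, ← (hL.commute k _).eq, map_mul, T.incl_incl,
    MulOpposite.op_mul, mul_smul,
    ← (S.murphyBasis r lam).sum_repr (MulOpposite.op (T.incl hk (L (k + 1))) • _), Finset.smul_sum,
    map_sum, Finsupp.finsetSum_apply, Finset.sum_eq_single t] at h1
  · rw [← h1, smul_comm, map_smul _ (_ : R), Finsupp.smul_apply, murphyBasis_apply,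
      S.repr_murphy_smul_of_scalar _ (hL.smul_jmProd _ _) (lt_irrefl _), S.repr_murphy, if_pos rfl,
      mul_one, smul_eq_mul]
  · intro s _ hs
    rw [smul_comm, map_smul _ (_ : R), Finsupp.smul_apply, murphyBasis_apply]
    by_cases hd : s.1.Dominates t.1
    · rw [S.repr_murphy_smul_of_scalar _ (hL.smul_jmProd _ _) (hd k _).not_gt, S.repr_murphy,
        if_neg hs, mul_zero, smul_zero]
    · rw [S.repr_murphy_smul_eq_zero hk (hL.commute k) hd, zero_smul]
  · exact fun h => absurd (Finset.mem_univ t) h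

open Classical in
/-- The expansion of `m_t L_{k+1}` in the Murphy basis, in the cell module and, modulo
`A_r^{▷ lam}`, in `A_r`. -/
theorem exists_murphy_smul_eq {L : ∀ r, T.A r} (hL : T.IsJMFamily L) {r : ℕ} {lam : T.Λ r}
    (t : T.Std r lam) {k : ℕ} (hk : k + 1 ≤ r) {κ : R}
    (hκ : (S.murphyBasis r lam).repr (S.murphy t <• T.incl hk (L (k + 1))) t = κ) :
    ∃ c : T.Std r lam → R,
      (S.murphy t <• T.incl hk (L (k + 1)) =
        κ • S.murphy t + ∑ s with s.1.StrictlyDominates t.1, c s • S.murphy s) ∧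
      S.murphyRep t * T.incl hk (L (k + 1)) -
        (κ • S.murphyRep t + ∑ s with s.1.StrictlyDominates t.1, c s • S.murphyRep s) ∈
        (T.cell r).idealGT lam := by
  set c := (S.murphyBasis r lam).repr (S.murphy t <• T.incl hk (L (k + 1))) with hc
  have hexp : S.murphy t <• T.incl hk (L (k + 1)) =
      κ • S.murphy t + ∑ s with s.1.StrictlyDominates t.1, c s • S.murphy s := by
    rw [← (S.murphyBasis r lam).sum_repr (MulOpposite.op (T.incl hk (L (k + 1))) • _),
      ← Finset.add_sum_erase _ _ (Finset.mem_univ t), ← hc, hκ, S.murphyBasis_apply]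
    congr 1
    simp only [S.murphyBasis_apply]
    symm
    refine Finset.sum_subset (fun s hs => ?_) fun s hs hs' => ?_
    · refine Finset.mem_erase.2 ⟨fun hst => ?_, Finset.mem_univ s⟩
      exact (Finset.mem_filter.1 hs).2.1 (congrArg Subtype.val hst)
    · have hd : ¬ s.1.Dominates t.1 := fun hd => hs' (Finset.mem_filter.2 ⟨Finset.mem_univ s,
        fun hst => Finset.ne_of_mem_erase hs (Subtype.ext hst), hd⟩)
      rw [hc, S.repr_murphy_smul_eq_zero hk (hL.commute k) hd, zero_smul]
  refine ⟨c, hexp, ?_⟩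
  have h := (S.δ_smul_eq_zero_iff (lam := lam) (S.dPath t.1 * T.incl hk (L (k + 1)) -
    (κ • S.dPath t.1 + ∑ s with s.1.StrictlyDominates t.1, c s • S.dPath s.1))).1 ?_
  · simpa only [murphyRep, mul_sub, mul_add, Finset.mul_sum, mul_smul_comm, mul_assoc] using h
  · simp only [MulOpposite.op_sub, MulOpposite.op_add, MulOpposite.op_mul, MulOpposite.op_smul,
      Finset.op_sum, sub_smul, add_smul, mul_smul, Finset.sum_smul, smul_assoc]
    exact sub_eq_zero.2 hexp

end DiagramStructure

open Classical in
theorem mainTheorem2 {R : Type u} {F : Type y} {B : Type v} [CommRing R] [IsDomain R] [Field F]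
    [Algebra R F] [IsFractionRing R F] [Ring B] [Algebra R B]
    (T : CellularTower.{u, v, w, x} R B) (S : DiagramStructure F T)
    (L : ∀ r, T.A r) (e : ∀ r, T.Λ r → R)
    (hL : T.IsAdditiveJM L e ∨ T.IsMultiplicativeJM L e) :
    ∃ κ : ∀ k, T.Λ k → T.Λ (k + 1) → R,
      (T.IsAdditiveJM L e → ∀ (k : ℕ) (mu : T.Λ k) (lam : T.Λ (k + 1)), T.Edge mu lam →
        κ k mu lam = e (k + 1) lam - e k mu) ∧
      (T.IsMultiplicativeJM L e → ∀ (k : ℕ) (mu : T.Λ k) (lam : T.Λ (k + 1)), T.Edge mu lam →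
        κ k mu lam * e k mu = e (k + 1) lam) ∧
      ∀ (r : ℕ) (lam : T.Λ r) (t : T.Std r lam) (k : ℕ) (hk : k + 1 ≤ r),
        ∃ c : T.Std r lam → R,
          (S.murphy t <• T.incl hk (L (k + 1)) =
            κ k (t.1.vertex k (k.le_succ.trans hk)) (t.1.vertex (k + 1) hk) • S.murphy t +
              ∑ s with s.1.StrictlyDominates t.1, c s • S.murphy s) ∧
          S.murphyRep t * T.incl hk (L (k + 1)) -
            (κ k (t.1.vertex k (k.le_succ.trans hk)) (t.1.vertex (k + 1) hk) • S.murphyRep t +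
              ∑ s with s.1.StrictlyDominates t.1, c s • S.murphyRep s) ∈
            (T.cell r).idealGT lam := by
  by_cases hmul : T.IsMultiplicativeJM L e
  · have hunit : ∀ (k : ℕ) (mu : T.Λ k), IsUnit (e k mu) := fun k mu =>
      hmul.isUnit_scalar (S.tab_nonempty k mu)
    refine ⟨fun k mu lam => e (k + 1) lam * Ring.inverse (e k mu), fun hadd => ?_,
      fun _ k mu lam _ => ?_, fun r lam t k hk => ?_⟩
    · -- The scalar attached to `Λ 0`, which is not empty, is not both `0` and `1`.
      have : Nontrivial (T.A 0) := S.zero_eq.1.nontrivial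
      obtain ⟨lam, -⟩ := (T.cell 0).c.index_nonempty.some
      exact absurd ((hadd.scalar_zero lam).symm.trans (hmul.scalar_zero lam)) zero_ne_one
    · rw [mul_assoc, Ring.inverse_mul_cancel _ (hunit k mu), mul_one]
    · refine S.exists_murphy_smul_eq hmul.toIsJMFamily t hk ?_
      beta_reduce
      rw [← S.repr_murphy_smul_of_isMultiplicativeJM hmul t hk, mul_assoc,
        Ring.mul_inverse_cancel _ (hunit _ _), mul_one]
  · have hadd := hL.resolve_right hmul
    exact ⟨fun k mu lam => e (k + 1) lam - e k mu, fun _ _ _ _ _ => rfl, fun h => absurd h hmul,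
      fun r lam t k hk => S.exists_murphy_smul_eq hadd.toIsJMFamily t hk
        (S.repr_murphy_smul_of_isAdditiveJM hadd t hk)⟩
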